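/- **Setting.** Let $\mathsf X,\mathsf Y,\mathsf U$ be measurable spaces, $\lambda_{\mathsf X},\lambda_{\mathsf Y}$ $\sigma$-finite reference measures on $\mathsf X,\mathsf Y$, $\nu$ a probability measure on $\mathsf U$, $\Theta$ a parameter set (for instance $\Theta\subseteq\mathbb R^p$), and $\varepsilon\in(0,1)$. For each $\theta\in\Theta$ let $m_\theta(x,x')$ and $r_\theta(x,y,x')$ be Markov transition densities in $x'$ with respect to $\lambda_{\mathsf X}$, and $g_\theta(x,y)$ a Markov transition density in $y$ with respect to $\lambda_{\mathsf Y}$, such that for all $\theta,x,x',y$ $$\varepsilon\le m_\theta(x,x')\le\varepsilon^{-1},\qquad \varepsilon\le g_\theta(x,y)\le\varepsilon^{-1},\qquad \varepsilon\le r_\theta(x,y,x')\le\varepsilon^{-1}.$$ Let $h_\theta:\mathsf X\times\mathsf Y\times\mathsf U\to\mathsf X$ be such that $h_\theta(x,y,U)$ has density $r_\theta(x,y,\cdot)$ whenever $U\sim\nu$. (All densities and $h_\theta$ are measurable for each $\theta$.) Let $m_0$ be a probability density with respect to $\lambda_{\mathsf X}$. The data $(Y_t)_{t\ge0}$ are the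 observations of a Markov chain $(X_t,Y_t)_{t\ge0}$ on a probability space $(\Omega,\mathcal F,\mathbb P)$ with $X_0\sim m_0\,d\lambda_{\mathsf X}$, $Y_0\mid X_0\sim g(X_0,y)\,\lambda_{\mathsf Y}(dy)$ and transition kernel $m(x,x')g(x',y')\,\lambda_{\mathsf X}(dx')\lambda_{\mathsf Y}(dy')$, where $m,g$ are Markov transition densities, not necessarily in the parametric family, and $\varepsilon\le m(x,x')\le\varepsilon^{-1}$ for all $x,x'$. Let $\phi_{\theta;t}$ be the filter, i.e. the $x_t$-marginal of the probability measure on $\mathsf X^{t+1}$ with density proportional to $m_0(x_0)g_\theta(x_0,Y_0)\prod_{s=1}^t m_\theta(x_{s-1},x_s)g_\theta(x_s,Y_s)$ with respect to $\lambda_{\mathsf X}^{\otimes(t+1)}$. For $y\in\mathsf Y$, a probability measure $\mu$ on $\mathsf X$ and $M\in\mathbb N_{>0}$ put $$L_\theta(y,\mu)=\log\iint g_\theta(x',y)\,m_\theta(x,x')\,\lambda_{\mathsf X}(dx')\,\mu(dx),\qquad L^M_\theta(y,\mu)=\mathbb E\Big[\log\Big(\frac1M\sum_{i=1}^M w_\theta(X^i,y,U^i)\Big)\Big],$$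 where $(X^i,U^i)_{i=1}^M$ are i.i.d. with law $\mu\otimes\nu$ and $$w_\theta(x,y,u)=\frac{m_\theta(x,h_\theta(x,y,u))\,g_\theta(h_\theta(x,y,u),y)}{r_\theta(x,y,h_\theta(x,y,u))}.$$ **Proposition 3.2.** There are functions $\ell:\Theta\to\mathbb R$ (the asymptotic contrast) and $\ell^M:\Theta\to\mathbb R$, $M\in\mathbb N_{>0}$ (the COLBO), such that for every $\theta\in\Theta$ and $M\in\mathbb N_{>0}$, $\mathbb P$-almost surely, $$\ell(\theta)=\lim_{T\to\infty}\frac1T\sum_{s=0}^{T-1}L_\theta(Y_{s+1},\phi_{\theta;s}),\qquad \ell^M(\theta)=\lim_{T\to\infty}\frac1T\sum_{s=0}^{T-1}L^M_\theta(Y_{s+1},\phi_{\theta;s}),$$ and they satisfy, for all $\theta\in\Theta$ and $M\in\mathbb N_{>0}$, $$\ell(\theta)\ \ge\ \ell^{M+1}(\theta)\ \ge\ \ell^{M}(\theta).$$ Moreover $\ell(\theta)-\ell^M(\theta)=\mathcal O(1/M)$ uniformly in $\theta$: there is a constant $C$ with $|\ell(\theta)-\ell^M(\theta)|\le C/M$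 for all $\theta$ and $M$. More precisely, there is a constant $C'$ such that for all $\theta$ and $M$, $$\ell(\theta)-\ell^M(\theta)\ \le\ \frac{\varepsilon^{-8}}{2M}+\frac{C'}{M^2}.$$ -/

import Mathlib

open MeasureTheory ProbabilityTheory Filter Topology
open scoped NNReal ENNReal

/-- The dynamics of a state-space model on `X × Y`: a latent transition density `m x x'` (density
of the next state `x'` given the state `x`) with respect to `lX`, and an emission density `g x y`
(density of the observation `y` given the state `x`) with respect to `lY`. -/
structure StateSpaceModel {X Y : Type*} [MeasurableSpace X] [MeasurableSpace Y]
    (lX : Measure X) (lY : Measure Y) where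
  m : X → X → ℝ≥0
  g : X → Y → ℝ≥0
  measurable_m : Measurable (Function.uncurry m)
  measurable_g : Measurable (Function.uncurry g)
  lintegral_m : ∀ x, ∫⁻ x', (m x x' : ℝ≥0∞) ∂lX = 1
  lintegral_g : ∀ x, ∫⁻ y, (g x y : ℝ≥0∞) ∂lY = 1

/-- A reparameterised proposal: a Markov transition density `r x y x'` (density of the proposed
next state `x'` given the state `x` and the new observation `y`) with respect to `lX`, and a map
`h` which turns noise distributed according to `ν` into a draw from that density. -/
structure Proposal {X U : Type*} [MeasurableSpace X] [MeasurableSpace U]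
    (Y : Type*) [MeasurableSpace Y] (lX : Measure X) (ν : Measure U) where
  r : X → Y → X → ℝ≥0
  h : X → Y → U → X
  measurable_r : Measurable (fun p : X × Y × X => r p.1 p.2.1 p.2.2)
  measurable_h : Measurable (fun p : X × Y × U => h p.1 p.2.1 p.2.2)
  lintegral_r : ∀ x y, ∫⁻ x', (r x y x' : ℝ≥0∞) ∂lX = 1
  map_h : ∀ x y, ν.map (h x y) = lX.withDensity (fun x' => (r x y x' : ℝ≥0∞))

noncomputable section

namespace StateSpaceModel

variable {X Y U : Type*} [MeasurableSpace X] [MeasurableSpace Y] [MeasurableSpace U]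
  {lX : Measure X} {lY : Measure Y} {ν : Measure U}

/-- The latent transition kernel `M(x, dx') = m(x, x') lX(dx')`. -/
def stateKernel [SigmaFinite lX] (S : StateSpaceModel lX lY) : Kernel X X :=
  Kernel.withDensity (Kernel.const X lX) (fun x x' => (S.m x x' : ℝ≥0∞))

/-- The emission kernel `G(x, dy) = g(x, y) lY(dy)`. -/
def emissionKernel [SigmaFinite lY] (S : StateSpaceModel lX lY) : Kernel X Y :=
  Kernel.withDensity (Kernel.const X lY) (fun x y => (S.g x y : ℝ≥0∞))

/-- The transition kernel of the bivariate chain,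
`S((x, y), d(x', y')) = M(x, dx') G(x', dy')`. -/
def jointKernel [SigmaFinite lX] [SigmaFinite lY] (S : StateSpaceModel lX lY) :
    Kernel (X × Y) (X × Y) :=
  Kernel.prodMkRight Y (S.stateKernel ⊗ₖ Kernel.prodMkLeft X S.emissionKernel)

instance [SigmaFinite lX] (S : StateSpaceModel lX lY) : IsMarkovKernel S.stateKernel := by
  refine ⟨fun x => ⟨?_⟩⟩
  have hm : Measurable (Function.uncurry fun x x' => (S.m x x' : ℝ≥0∞)) :=
    measurable_coe_nnreal_ennreal.comp S.measurable_m
  rw [stateKernel, Kernel.withDensity_apply' _ hm]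
  simpa using S.lintegral_m x

instance [SigmaFinite lY] (S : StateSpaceModel lX lY) : IsMarkovKernel S.emissionKernel := by
  refine ⟨fun x => ⟨?_⟩⟩
  have hg : Measurable (Function.uncurry fun x y => (S.g x y : ℝ≥0∞)) :=
    measurable_coe_nnreal_ennreal.comp S.measurable_g
  rw [emissionKernel, Kernel.withDensity_apply' _ hg]
  simpa using S.lintegral_g x

instance [SigmaFinite lX] [SigmaFinite lY] (S : StateSpaceModel lX lY) :
    IsMarkovKernel S.jointKernel := by
  unfold jointKernel; infer_instance

/-- The joint density of states `x₀, …, x_t` and observations `y₀, …, y_t`,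
`m₀(x₀) g(x₀, y₀) ∏_{s=1}^t m(x_{s-1}, x_s) g(x_s, y_s)`. -/
def jointDensity (S : StateSpaceModel lX lY) (m₀ : X → ℝ≥0) (t : ℕ) (x : Fin (t + 1) → X)
    (y : ℕ → Y) : ℝ≥0 :=
  m₀ (x 0) * S.g (x 0) (y 0) *
    ∏ s : Fin t, (S.m (x s.castSucc) (x s.succ) * S.g (x s.succ) (y (s + 1)))

/-- The unnormalised filter: the `x_t`-marginal of the joint density, as a measure on `X`. -/
def unnormalizedFilter [SigmaFinite lX] (S : StateSpaceModel lX lY) (m₀ : X → ℝ≥0) (t : ℕ)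
    (y : ℕ → Y) : Measure X :=
  ((Measure.pi fun _ : Fin (t + 1) => lX).withDensity
    (fun x => (S.jointDensity m₀ t x y : ℝ≥0∞))).map (fun x => x (Fin.last t))

/-- The filter `φ_t`, the conditional law of the state `X_t` given `Y₀ = y₀, …, Y_t = y_t`
under the model. It depends on `y` only through `y₀, …, y_t`. -/
def filter [SigmaFinite lX] (S : StateSpaceModel lX lY) (m₀ : X → ℝ≥0) (t : ℕ)
    (y : ℕ → Y) : Measure X :=
  (S.unnormalizedFilter m₀ t y Set.univ)⁻¹ • S.unnormalizedFilter m₀ t y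

/-- The predictive log-likelihood
`L(y, μ) = log ∫∫ g(x', y) m(x, x') lX(dx') μ(dx)`. -/
def logLik (S : StateSpaceModel lX lY) (y : Y) (μ : Measure X) : ℝ :=
  Real.log (∫ x, ∫ x', (S.g x' y : ℝ) * (S.m x x' : ℝ) ∂lX ∂μ)

/-- The importance weight
`w(x, y, u) = m(x, h(x, y, u)) g(h(x, y, u), y) / r(x, y, h(x, y, u))`. -/
def weight (S : StateSpaceModel lX lY) (Q : Proposal Y lX ν) (x : X) (y : Y) (u : U) : ℝ :=
  (S.m x (Q.h x y u) : ℝ) * (S.g (Q.h x y u) y : ℝ) / (Q.r x y (Q.h x y u) : ℝ)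

/-- The importance-weighted bound with `M` samples: the expectation of
`log (M⁻¹ ∑ᵢ w(Xⁱ, y, Uⁱ))` for `(Xⁱ, Uⁱ)`, `i = 1, …, M`, i.i.d. with law `μ ⊗ ν`. -/
def iwaeBound (S : StateSpaceModel lX lY) (Q : Proposal Y lX ν) (M : ℕ) (y : Y)
    (μ : Measure X) : ℝ :=
  ∫ z : Fin M → X × U,
    Real.log ((M : ℝ)⁻¹ * ∑ i, S.weight Q (z i).1 y (z i).2) ∂(Measure.pi fun _ => μ.prod ν)

end StateSpaceModel

section

variable {X Y U Θ Ω : Type*} [MeasurableSpace X] [MeasurableSpace Y] [MeasurableSpace U]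
  [MeasurableSpace Ω] {lX : Measure X} {lY : Measure Y} {ν : Measure U}

/-- Under `P`, the process `(Xs t, Ys t)` is a Markov chain with transition kernel
`D.jointKernel`, with `Xs 0` of density `m₀` and `Ys 0` drawn from the emission kernel given
`Xs 0`. The Markov property says that, given `(Xs s, Ys s)` for `s = 0, …, t`, the conditional law
of `(Xs (t+1), Ys (t+1))` is `D.jointKernel (Xs t, Ys t)`. -/
structure IsOutputOf [SigmaFinite lX] [SigmaFinite lY] (P : Measure Ω)
    (Xs : ℕ → Ω → X) (Ys : ℕ → Ω → Y) (D : StateSpaceModel lX lY) (m₀ : X → ℝ≥0) : Prop where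
  measurable_state : ∀ t, Measurable (Xs t)
  measurable_obs : ∀ t, Measurable (Ys t)
  initial : P.map (fun ω => (Xs 0 ω, Ys 0 ω)) =
    (lX.withDensity fun x => (m₀ x : ℝ≥0∞)) ⊗ₘ D.emissionKernel
  markov : ∀ t : ℕ,
    P.map (fun ω => (fun s : Fin (t + 1) => (Xs s ω, Ys s ω), (Xs (t + 1) ω, Ys (t + 1) ω))) =
      (P.map (fun ω => fun s : Fin (t + 1) => (Xs s ω, Ys s ω))) ⊗ₘ
        D.jointKernel.comap (fun z => z (Fin.last t)) (measurable_pi_apply (Fin.last t))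

/-- `ℓ` is the asymptotic contrast function: for every `θ`, almost surely,
`ℓ θ = lim_T T⁻¹ ∑_{s<T} L_θ(Y_{s+1}, φ_{θ,s})`. -/
def IsContrast [SigmaFinite lX] (P : Measure Ω) (Ys : ℕ → Ω → Y)
    (S : Θ → StateSpaceModel lX lY) (m₀ : X → ℝ≥0) (ℓ : Θ → ℝ) : Prop :=
  ∀ θ, ∀ᵐ ω ∂P, Tendsto
    (fun T : ℕ => (T : ℝ)⁻¹ * ∑ s ∈ Finset.range T,
      (S θ).logLik (Ys (s + 1) ω) ((S θ).filter m₀ s (fun t => Ys t ω)))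
    atTop (𝓝 (ℓ θ))

/-- `ℓM` is the contrast lower bound (COLBO) with sample size `M`: for every `θ`, almost surely,
`ℓM θ = lim_T T⁻¹ ∑_{s<T} L^M_θ(Y_{s+1}, φ_{θ,s})`. -/
def IsCOLBO [SigmaFinite lX] (P : Measure Ω) (Ys : ℕ → Ω → Y)
    (S : Θ → StateSpaceModel lX lY) (Q : Θ → Proposal Y lX ν) (m₀ : X → ℝ≥0) (M : ℕ)
    (ℓM : Θ → ℝ) : Prop :=
  ∀ θ, ∀ᵐ ω ∂P, Tendsto
    (fun T : ℕ => (T : ℝ)⁻¹ * ∑ s ∈ Finset.range T,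
      (S θ).iwaeBound (Q θ) M (Ys (s + 1) ω) ((S θ).filter m₀ s (fun t => Ys t ω)))
    atTop (𝓝 (ℓM θ))

end

end

/-! The proof separates a deterministic comparison of the two functionals from an ergodic theorem
that produces both limits.

For fixed `y` and `μ`, the weights `w(X, y, U)` are unbiased for the predictive likelihood: `ν` is
pushed to the density `r`, which cancels the denominator. So `L` is the log of a mean and `L^M` the
expected log of an empirical mean. Jensen's inequality gives `L^M ≤ L`. It also gives monotonicity
in `M`, because a mean of `M + 1` terms is the average of its leave-one-out means. For the gap, a
quadratic upper bound on `-log` reduces matters to the variance of the empirical mean, of order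
`1/M`. Since the weights lie in `[ε ^ 3, ε⁻¹ ^ 3]`, the gap is at most `ε⁻¹ ^ 6 / (2 * M)`, with no
remainder of order `1/M²`.

Existence of the limits rests on two geometric contractions, both with factor `1 - ε ^ 2`. First,
the filter forgets its past: two filters sharing their last `k` observations differ by at most `(1 -
ε ^ 2) ^ k` on functions of oscillation one (`filter_forgetting`). As `L` and `L^M` are Lipschitz in
the measure, replacing the filter by one restarted `k` steps ago costs a uniformly small error and
leaves a function of finitely many recent states of the data chain. Second, the data chain satisfies
a Doeblin condition, so correlations of such functions are summable and a strong law holds from any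
initial law (`HasMarkovProperty.exists_tendsto_cesaro`). Letting `k` grow gives the limits
(`exists_tendsto_cesaro_filter`). The pointwise inequalities between `L` and `L^M` then pass to
Cesàro limits along a single sample path. -/

/-! ### Importance-weighted log-means: Jensen bounds, the variance gap, and dependence on the
sampling law. -/

section ImportanceWeighting

/-- A global quadratic bound replacing a Taylor expansion, so that no remainder term appears in the
gap estimate. Below `1` it is `x ≤ sinh x` at `x = -log u`, which gives the sharp denominator `2 *
u`; above `1` it follows from `2x / (x + 2) ≤ log (1 + x)`. -/
theorem neg_log_add_sub_one_le {u δ : ℝ} (hδ : 0 < δ) (hδ1 : δ ≤ 1) (hu : δ ≤ u) :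
    -Real.log u + u - 1 ≤ (u - 1) ^ 2 / (2 * δ) := by
  have hu0 : 0 < u := hδ.trans_le hu
  rcases le_total u 1 with h | h
  · have h1 : -Real.log u ≤ (u⁻¹ - u) / 2 := by
      have h2 := Real.self_le_sinh_iff.2 (neg_nonneg.2 (Real.log_nonpos hu0.le h))
      rw [Real.sinh_neg, Real.sinh_log hu0] at h2
      linarith
    have h3 : (u⁻¹ - u) / 2 + u - 1 = (u - 1) ^ 2 / (2 * u) := by field_simp; ring
    calc -Real.log u + u - 1 ≤ (u - 1) ^ 2 / (2 * u) := by linarith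
      _ ≤ _ := by gcongr
  · have h1 : -Real.log u + u - 1 ≤ (u - 1) ^ 2 / 2 := by
      have h5 := Real.le_log_one_add_of_nonneg (sub_nonneg.2 h)
      have h6 : u - 1 - (u - 1) ^ 2 / 2 ≤ 2 * (u - 1) / (u - 1 + 2) := by
        rw [le_div_iff₀ (by linarith)]
        have : 0 ≤ (u - 1) ^ 3 := pow_nonneg (sub_nonneg.2 h) 3
        nlinarith
      rw [add_sub_cancel] at h5
      linarith
    refine h1.trans ?_
    gcongr
    linarith

variable {Z : Type*} [MeasurableSpace Z]

/-- The expected logarithm of the mean of `M` independent weights. -/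
noncomputable def iwLogMean (ρ : Measure Z) (w : Z → ℝ) (M : ℕ) : ℝ :=
  ∫ z : Fin M → Z, Real.log ((M : ℝ)⁻¹ * ∑ i, w (z i)) ∂(Measure.pi fun _ => ρ)

theorem integrable_of_mem_Icc {α : Type*} [MeasurableSpace α] {μ : Measure α} [IsFiniteMeasure μ]
    {f : α → ℝ} (hf : Measurable f) {a b : ℝ} (h : ∀ x, f x ∈ Set.Icc a b) : Integrable f μ :=
  Integrable.of_mem_Icc a b hf.aemeasurable (Eventually.of_forall h)

theorem integral_mem_Icc {α : Type*} [MeasurableSpace α] {μ : Measure α} [IsProbabilityMeasure μ]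
    {f : α → ℝ} (hf : Measurable f) {a b : ℝ} (h : ∀ x, f x ∈ Set.Icc a b) :
    ∫ x, f x ∂μ ∈ Set.Icc a b := by
  have hi := integrable_of_mem_Icc (μ := μ) hf h
  constructor
  · simpa using integral_mono (integrable_const a) hi fun x => (h x).1
  · simpa using integral_mono hi (integrable_const b) fun x => (h x).2

section

variable {ρ : Measure Z} [IsProbabilityMeasure ρ] {w : Z → ℝ} {a b : ℝ}

theorem measurable_mean (hw : Measurable w) (M : ℕ) :
    Measurable fun z : Fin M → Z => (M : ℝ)⁻¹ * ∑ i, w (z i) := by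
  fun_prop

omit [MeasurableSpace Z] in
theorem mean_mem_Icc (hwab : ∀ z, w z ∈ Set.Icc a b) {M : ℕ} (hM : 1 ≤ M) (z : Fin M → Z) :
    (M : ℝ)⁻¹ * ∑ i, w (z i) ∈ Set.Icc a b := by
  have hM0 : (0 : ℝ) < M := by exact_mod_cast hM
  have h1 : ∑ _i : Fin M, a ≤ ∑ i, w (z i) := Finset.sum_le_sum fun i _ => (hwab (z i)).1
  have h2 : ∑ i, w (z i) ≤ ∑ _i : Fin M, b := Finset.sum_le_sum fun i _ => (hwab (z i)).2
  simp only [Finset.sum_const, Finset.card_univ, Fintype.card_fin, nsmul_eq_mul] at h1 h2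
  constructor
  · rw [inv_mul_eq_div, le_div_iff₀ hM0]; linarith
  · rw [inv_mul_eq_div, div_le_iff₀ hM0]; linarith

theorem log_mem_Icc (ha : 0 < a) {x : ℝ} (hx : x ∈ Set.Icc a b) :
    Real.log x ∈ Set.Icc (Real.log a) (Real.log b) :=
  ⟨Real.log_le_log ha hx.1, Real.log_le_log (ha.trans_le hx.1) hx.2⟩

theorem measurable_log_mean (hw : Measurable w) (M : ℕ) :
    Measurable fun z : Fin M → Z => Real.log ((M : ℝ)⁻¹ * ∑ i, w (z i)) :=
  Real.measurable_log.comp (measurable_mean hw M)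

theorem integrable_log_mean (hw : Measurable w) (ha : 0 < a) (hwab : ∀ z, w z ∈ Set.Icc a b)
    {M : ℕ} (hM : 1 ≤ M) :
    Integrable (fun z : Fin M → Z => Real.log ((M : ℝ)⁻¹ * ∑ i, w (z i)))
      (Measure.pi fun _ => ρ) :=
  integrable_of_mem_Icc (measurable_log_mean hw M)
    fun z => log_mem_Icc ha (mean_mem_Icc hwab hM z)

theorem integral_mean (hw : Measurable w) (hwab : ∀ z, w z ∈ Set.Icc a b) {M : ℕ} (hM : 1 ≤ M) :
    ∫ z : Fin M → Z, (M : ℝ)⁻¹ * ∑ i, w (z i) ∂(Measure.pi fun _ => ρ) = ∫ z, w z ∂ρ := by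
  have hM0 : (M : ℝ) ≠ 0 := by positivity
  rw [integral_const_mul, integral_finsetSum]
  · have : ∀ i : Fin M, ∫ z : Fin M → Z, w (z i) ∂(Measure.pi fun _ => ρ) = ∫ z, w z ∂ρ :=
      fun i => integral_comp_eval (μ := fun _ : Fin M => ρ) (i := i) hw.aestronglyMeasurable
    simp [this, hM0]
  · intro i _
    exact integrable_of_mem_Icc (hw.comp (measurable_pi_apply i)) fun z => hwab (z i)

/-- Jensen, through the tangent line of `log` at the mean `I`: the linear term integrates to zero.
-/
theorem iwLogMean_le_log_integral (hw : Measurable w) (ha : 0 < a)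
    (hwab : ∀ z, w z ∈ Set.Icc a b) {M : ℕ} (hM : 1 ≤ M) :
    iwLogMean ρ w M ≤ Real.log (∫ z, w z ∂ρ) := by
  set I := ∫ z, w z ∂ρ with hI
  have hI0 : 0 < I := ha.trans_le (integral_mem_Icc hw hwab).1
  have hint := integrable_of_mem_Icc (μ := Measure.pi fun _ : Fin M => ρ) (measurable_mean hw M)
    (mean_mem_Icc hwab hM)
  have hint' : Integrable (fun z : Fin M → Z => ((M : ℝ)⁻¹ * ∑ i, w (z i)) / I - 1)
      (Measure.pi fun _ => ρ) := (hint.div_const I).sub (integrable_const _)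
  have key : iwLogMean ρ w M ≤ ∫ z : Fin M → Z, (Real.log I + (((M : ℝ)⁻¹ * ∑ i, w (z i)) / I - 1))
      ∂(Measure.pi fun _ => ρ) := by
    refine integral_mono (integrable_log_mean hw ha hwab hM)
      ((integrable_const _).add hint') fun z => ?_
    have hz : 0 < (M : ℝ)⁻¹ * ∑ i, w (z i) := ha.trans_le (mean_mem_Icc hwab hM z).1
    have := Real.log_le_sub_one_of_pos (div_pos hz hI0)
    rw [Real.log_div hz.ne' hI0.ne'] at this
    dsimp only
    linarith
  rw [integral_add (integrable_const _) hint',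
    integral_sub (hint.div_const I) (integrable_const _), integral_div, integral_mean hw hwab hM,
    ← hI, div_self hI0.ne'] at key
  simpa using key

/-- The quadratic bound at `u = q / I`, with `q` the empirical mean, leaves a linear term of mean
zero and the variance of `q` over `2 * a * I`. Bounding the variance by `b * I / M` makes `I`
cancel, so only the ratio `b / a` survives. -/
theorem log_integral_sub_iwLogMean_le (hw : Measurable w) (ha : 0 < a)
    (hwab : ∀ z, w z ∈ Set.Icc a b) {M : ℕ} (hM : 1 ≤ M) :
    Real.log (∫ z, w z ∂ρ) - iwLogMean ρ w M ≤ b / a / (2 * M) := by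
  set I := ∫ z, w z ∂ρ with hI
  have hIab : I ∈ Set.Icc a b := integral_mem_Icc hw hwab
  have hI0 : 0 < I := ha.trans_le hIab.1
  have hM0 : (0 : ℝ) < M := by exact_mod_cast hM
  have hint := integrable_of_mem_Icc (μ := Measure.pi fun _ : Fin M => ρ) (measurable_mean hw M)
    (mean_mem_Icc hwab hM)
  have hlog := integrable_log_mean (ρ := ρ) hw ha hwab hM
  have hmem : MemLp (fun z : Fin M → Z => (M : ℝ)⁻¹ * ∑ i, w (z i)) 2 (Measure.pi fun _ => ρ) :=
    memLp_of_bounded (Eventually.of_forall (mean_mem_Icc hwab hM))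
      (measurable_mean hw M).aestronglyMeasurable 2
  have hwmem : MemLp w 2 ρ := memLp_of_bounded (Eventually.of_forall hwab)
      hw.aestronglyMeasurable 2
  have hsq : Integrable (fun z : Fin M → Z => ((M : ℝ)⁻¹ * ∑ i, w (z i) - I) ^ 2)
      (Measure.pi fun _ => ρ) := (hmem.sub (memLp_const I)).integrable_sq
  have hint' : Integrable (fun z : Fin M → Z => 1 - ((M : ℝ)⁻¹ * ∑ i, w (z i)) / I)
      (Measure.pi fun _ => ρ) := (integrable_const _).sub (hint.div_const I)
  have key : Real.log I - iwLogMean ρ w M ≤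
      ∫ z : Fin M → Z, ((1 - ((M : ℝ)⁻¹ * ∑ i, w (z i)) / I) +
        ((M : ℝ)⁻¹ * ∑ i, w (z i) - I) ^ 2 / (2 * (a * I))) ∂(Measure.pi fun _ => ρ) := by
    have : Real.log I - iwLogMean ρ w M = ∫ z : Fin M → Z,
        (Real.log I - Real.log ((M : ℝ)⁻¹ * ∑ i, w (z i))) ∂(Measure.pi fun _ => ρ) := by
      rw [integral_sub (integrable_const _) hlog]; simp [iwLogMean]
    rw [this]
    refine integral_mono ((integrable_const _).sub hlog)
      (hint'.add (hsq.div_const _)) fun z => ?_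
    have hz := mean_mem_Icc hwab hM z
    have hz0 : 0 < (M : ℝ)⁻¹ * ∑ i, w (z i) := ha.trans_le hz.1
    dsimp only
    generalize (M : ℝ)⁻¹ * ∑ i, w (z i) = q at hz hz0
    have := neg_log_add_sub_one_le (u := q / I) (div_pos ha hI0)
      ((div_le_one hI0).2 hIab.1) (by gcongr; exact hz.1)
    rw [Real.log_div hz0.ne' hI0.ne'] at this
    have e : (q / I - 1) ^ 2 / (2 * (a / I)) = (q - I) ^ 2 / (2 * (a * I)) := by
      field_simp
    linarith
  have hvar : ∫ z : Fin M → Z, ((M : ℝ)⁻¹ * ∑ i, w (z i) - I) ^ 2 ∂(Measure.pi fun _ => ρ)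
      ≤ b * I / M := by
    have h1 : Var[fun z : Fin M → Z => (M : ℝ)⁻¹ * ∑ i, w (z i); Measure.pi fun _ => ρ]
        = ∫ z : Fin M → Z, ((M : ℝ)⁻¹ * ∑ i, w (z i) - I) ^ 2 ∂(Measure.pi fun _ => ρ) := by
      rw [variance_eq_integral (measurable_mean hw M).aemeasurable, integral_mean hw hwab hM]
    have h2 : Var[∑ i, fun z : Fin M → Z => w (z i); Measure.pi fun _ => ρ]
        = ∑ _i : Fin M, Var[w; ρ] :=
      variance_sum_pi (μ := fun _ : Fin M => ρ) (X := fun _ => w) fun _ => hwmem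
    have h3 : (fun z : Fin M → Z => (M : ℝ)⁻¹ * ∑ i, w (z i))
        = fun z => (M : ℝ)⁻¹ * (∑ i, fun z : Fin M → Z => w (z i)) z := by
      funext z; simp
    rw [← h1, h3, variance_const_mul, h2]
    -- The second moment is bounded by `w ^ 2 ≤ b * w`, not `b ^ 2`: this keeps the factor `I` that
    -- cancels at the end.
    have h4 : Var[w; ρ] ≤ b * I := by
      refine (variance_le_expectation_sq hw.aestronglyMeasurable).trans ?_
      rw [hI, ← integral_const_mul]
      refine integral_mono hwmem.integrable_sq
        ((integrable_of_mem_Icc hw hwab).const_mul b) fun z => ?_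
      simp only [Pi.pow_apply, sq]
      exact mul_le_mul_of_nonneg_right (hwab z).2 (ha.le.trans (hwab z).1)
    simp only [Finset.sum_const, Finset.card_univ, Fintype.card_fin, nsmul_eq_mul]
    calc ((M : ℝ)⁻¹) ^ 2 * (M * Var[w; ρ]) = Var[w; ρ] / M := by field_simp
      _ ≤ b * I / M := by gcongr
  rw [integral_add hint' (hsq.div_const _),
    integral_sub (integrable_const _) (hint.div_const I), integral_div, integral_div,
    integral_mean hw hwab hM, ← hI, div_self hI0.ne'] at key
  simp only [integral_const, probReal_univ, smul_eq_mul, mul_one, sub_self, zero_add] at key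
  refine key.trans ?_
  calc _ ≤ b * I / M / (2 * (a * I)) := by gcongr
    _ = b / a / (2 * M) := by field_simp

/-- Each index is left out exactly once, hence counted `M` times. -/
theorem sum_sum_succAbove {M : ℕ} (f : Fin (M + 1) → ℝ) :
    ∑ j : Fin (M + 1), ∑ i : Fin M, f (j.succAbove i) = M * ∑ i, f i := by
  have : ∀ j : Fin (M + 1), ∑ i : Fin M, f (j.succAbove i) = ∑ i, f i - f j := fun j => by
    rw [Fin.sum_univ_succAbove f j]; ring
  simp only [this, Finset.sum_sub_distrib, Finset.sum_const, Finset.card_univ, Fintype.card_fin,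
    nsmul_eq_mul]
  push_cast; ring

theorem measurePreserving_removeNth {M : ℕ} (j : Fin (M + 1)) :
    MeasurePreserving (fun (z : Fin (M + 1) → Z) (i : Fin M) => z (j.succAbove i))
      (Measure.pi fun _ => ρ) (Measure.pi fun _ => ρ) :=
  measurePreserving_snd.comp (measurePreserving_piFinSuccAbove (fun _ : Fin (M + 1) => ρ) j)

/-- The mean of `M + 1` weights is the average over `j` of the means omitting the `j`-th. Each of
these has the law of a mean of `M` weights, so concavity of `log` gives the inequality. -/
theorem iwLogMean_le_succ (hw : Measurable w) (ha : 0 < a)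
    (hwab : ∀ z, w z ∈ Set.Icc a b) {M : ℕ} (hM : 1 ≤ M) :
    iwLogMean ρ w M ≤ iwLogMean ρ w (M + 1) := by
  have hM0 : (0 : ℝ) < M := by exact_mod_cast hM
  have hj : ∀ j : Fin (M + 1), ∫ z : Fin (M + 1) → Z,
      Real.log ((M : ℝ)⁻¹ * ∑ i, w (z (j.succAbove i))) ∂(Measure.pi fun _ => ρ)
        = iwLogMean ρ w M := by
    intro j
    have hmp := measurePreserving_removeNth (ρ := ρ) j
    rw [iwLogMean, ← hmp.map_eq, integral_map hmp.measurable.aemeasurable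
      (measurable_log_mean hw M).aestronglyMeasurable]
  have hji : ∀ j : Fin (M + 1), Integrable (fun z : Fin (M + 1) → Z =>
      Real.log ((M : ℝ)⁻¹ * ∑ i, w (z (j.succAbove i)))) (Measure.pi fun _ => ρ) := fun j =>
    (measurePreserving_removeNth (ρ := ρ) j).integrable_comp_of_integrable
      (integrable_log_mean hw ha hwab hM)
  have hsum : iwLogMean ρ w M = ∫ z : Fin (M + 1) → Z, ∑ j : Fin (M + 1), ((M + 1 : ℕ) : ℝ)⁻¹ *
      Real.log ((M : ℝ)⁻¹ * ∑ i, w (z (j.succAbove i))) ∂(Measure.pi fun _ => ρ) := by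
    rw [integral_finsetSum _ fun j _ => (hji j).const_mul _]
    simp only [integral_const_mul, hj, Finset.sum_const, Finset.card_univ, Fintype.card_fin,
      nsmul_eq_mul]
    field_simp
  rw [hsum]
  refine integral_mono (integrable_finsetSum _ fun j _ => (hji j).const_mul _)
    (integrable_log_mean hw ha hwab (by omega)) fun z => ?_
  have hJ := strictConcaveOn_log_Ioi.concaveOn.le_map_sum (t := Finset.univ)
    (w := fun _ : Fin (M + 1) => ((M + 1 : ℕ) : ℝ)⁻¹)
    (p := fun j => (M : ℝ)⁻¹ * ∑ i, w (z (j.succAbove i))) (fun _ _ => by positivity)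
    (by simp only [Finset.sum_const, Finset.card_univ, Fintype.card_fin, nsmul_eq_mul]
        field_simp)
    (fun j _ => ha.trans_le (mean_mem_Icc hwab hM fun i => z (j.succAbove i)).1)
  simp only [smul_eq_mul] at hJ
  refine hJ.trans (le_of_eq ?_)
  congr 1
  rw [← Finset.mul_sum, ← Finset.mul_sum, sum_sum_succAbove fun i => w (z i)]
  field_simp

end

/-- A bound on the difference of the integrals of bounded functions passes to `M`-fold products. -/
theorem abs_integral_pi_sub_le {μ μ' : Measure Z} [IsProbabilityMeasure μ]
    [IsProbabilityMeasure μ'] {δ : ℝ}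
    (h : ∀ (f : Z → ℝ) (a b : ℝ), Measurable f → (∀ x, f x ∈ Set.Icc a b) →
      |∫ x, f x ∂μ - ∫ x, f x ∂μ'| ≤ δ * (b - a)) (M : ℕ) {G : (Fin M → Z) → ℝ} {a b : ℝ}
    (hG : Measurable G) (hGab : ∀ z, G z ∈ Set.Icc a b) :
    |∫ z, G z ∂(Measure.pi fun _ => μ) - ∫ z, G z ∂(Measure.pi fun _ => μ')|
      ≤ M * δ * (b - a) := by
  induction M with
  | zero => simp [Measure.pi_of_empty _ (Fin.elim0 : Fin 0 → Z)]
  | succ M ih =>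
    -- Hybrid argument: coordinate `0` is split off, its law is exchanged at cost `δ * (b - a)`, and
    -- the induction hypothesis exchanges the remaining `M` coordinates.
    set e := (MeasurableEquiv.piFinSuccAbove (fun _ : Fin (M + 1) => Z) 0).symm
    have hrep : ∀ (μ₀ : Measure Z) [IsProbabilityMeasure μ₀],
        ∫ z, G z ∂(Measure.pi fun _ => μ₀) =
          ∫ x, ∫ z, G (e (x, z)) ∂(Measure.pi fun _ : Fin M => μ₀) ∂μ₀ := by
      intro μ₀ _
      rw [← ((measurePreserving_piFinSuccAbove (fun _ : Fin (M + 1) => μ₀) 0).symm).integral_comp'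
        (g := G), integral_prod]
      exact integrable_of_mem_Icc (hG.comp (MeasurableEquiv.measurable _)) fun z => hGab _
    have hGc : Measurable fun p : Z × (Fin M → Z) => G (e p) := hG.comp e.measurable
    have hmeas : ∀ (μ₀ : Measure Z) [IsProbabilityMeasure μ₀], Measurable fun x =>
        ∫ z, G (e (x, z)) ∂(Measure.pi fun _ : Fin M => μ₀) := fun μ₀ _ =>
      (hGc.stronglyMeasurable.integral_prod_right).measurable
    have hmem : ∀ (μ₀ : Measure Z) [IsProbabilityMeasure μ₀] x,
        ∫ z, G (e (x, z)) ∂(Measure.pi fun _ : Fin M => μ₀) ∈ Set.Icc a b := fun μ₀ _ x =>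
      integral_mem_Icc (hGc.comp measurable_prodMk_left) fun z => hGab _
    have h1 := h _ a b (hmeas μ) (hmem μ)
    have h2 : |∫ x, ∫ z, G (e (x, z)) ∂(Measure.pi fun _ : Fin M => μ) ∂μ' -
        ∫ x, ∫ z, G (e (x, z)) ∂(Measure.pi fun _ : Fin M => μ') ∂μ'| ≤ M * δ * (b - a) := by
      rw [← integral_sub (integrable_of_mem_Icc (hmeas μ) (hmem μ))
        (integrable_of_mem_Icc (hmeas μ') (hmem μ'))]
      have hb : ∀ x, ‖∫ z, G (e (x, z)) ∂(Measure.pi fun _ : Fin M => μ) -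
          ∫ z, G (e (x, z)) ∂(Measure.pi fun _ : Fin M => μ')‖ ≤ M * δ * (b - a) := fun x =>
        ih (hGc.comp measurable_prodMk_left) fun z => hGab _
      simpa using norm_integral_le_of_norm_le_const (μ := μ') (Eventually.of_forall hb)
    rw [hrep μ, hrep μ']
    push_cast
    calc _ ≤ _ := abs_sub_le _
          (∫ x, ∫ z, G (e (x, z)) ∂(Measure.pi fun _ : Fin M => μ) ∂μ') _
      _ ≤ (M + 1) * δ * (b - a) := by linarith

theorem abs_integral_prod_sub_le {X U : Type*} [MeasurableSpace X] [MeasurableSpace U]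
    {μ μ' : Measure X} [IsProbabilityMeasure μ] [IsProbabilityMeasure μ'] {ν : Measure U}
    [IsProbabilityMeasure ν] {δ : ℝ}
    (h : ∀ (f : X → ℝ) (a b : ℝ), Measurable f → (∀ x, f x ∈ Set.Icc a b) →
      |∫ x, f x ∂μ - ∫ x, f x ∂μ'| ≤ δ * (b - a)) {f : X × U → ℝ} {a b : ℝ}
    (hf : Measurable f) (hfab : ∀ z, f z ∈ Set.Icc a b) :
    |∫ z, f z ∂(μ.prod ν) - ∫ z, f z ∂(μ'.prod ν)| ≤ δ * (b - a) := by
  rw [integral_prod _ (integrable_of_mem_Icc hf hfab),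
    integral_prod _ (integrable_of_mem_Icc hf hfab)]
  exact h _ a b hf.stronglyMeasurable.integral_prod_right'.measurable fun x =>
    integral_mem_Icc (hf.comp measurable_prodMk_left) fun u => hfab _

/-- The `M`-fold product of a Markov kernel depends measurably on the parameter. -/
theorem measurable_pi_kernel {α : Type*} [MeasurableSpace α] (κ : Kernel α Z)
    [IsMarkovKernel κ] (M : ℕ) : Measurable fun x => Measure.pi fun _ : Fin M => κ x := by
  induction M with
  | zero =>
    have : (fun x => Measure.pi fun _ : Fin 0 => κ x) = fun _ => Measure.dirac Fin.elim0 :=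
      funext fun x => Measure.pi_of_empty _ _
    rw [this]; exact measurable_const
  | succ M ih =>
    let κM : Kernel α (Fin M → Z) := ⟨_, ih⟩
    have : IsMarkovKernel κM :=
      ⟨fun x => inferInstanceAs (IsProbabilityMeasure (Measure.pi fun _ : Fin M => κ x))⟩
    set e := (MeasurableEquiv.piFinSuccAbove (fun _ : Fin (M + 1) => Z) 0).symm
    have : (fun x => Measure.pi fun _ : Fin (M + 1) => κ x) = ⇑((κ ×ₖ κM).map e) := by
      funext x
      rw [Kernel.map_apply _ e.measurable, Kernel.prod_apply]
      exact ((measurePreserving_piFinSuccAbove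
        (fun _ : Fin (M + 1) => κ x) 0).symm).map_eq.symm
    rw [this]
    exact Kernel.measurable _

/-- Integrals against the `M`-fold product of a Markov kernel are measurable. -/
theorem measurable_integral_pi_kernel {α : Type*} [MeasurableSpace α] (κ : Kernel α Z)
    [IsMarkovKernel κ] (M : ℕ) {G : α × (Fin M → Z) → ℝ} (hG : Measurable G) :
    Measurable fun x => ∫ z, G (x, z) ∂(Measure.pi fun _ => κ x) := by
  let κM : Kernel α (Fin M → Z) := ⟨_, measurable_pi_kernel κ M⟩
  have : IsMarkovKernel κM :=
    ⟨fun x => inferInstanceAs (IsProbabilityMeasure (Measure.pi fun _ : Fin M => κ x))⟩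
  exact (hG.stronglyMeasurable.integral_kernel_prod_right' (κ := κM)).measurable

end ImportanceWeighting

/-! ### A strong law from summable correlations, and Cesàro limits of approximations. -/

section LawOfLargeNumbers

theorem eventually_succ_sq_le {a : ℝ} (ha : 1 < a) :
    ∀ᶠ n : ℕ in atTop, (((n + 1) ^ 2 : ℕ) : ℝ) ≤ a * ((n ^ 2 : ℕ) : ℝ) := by
  have h : Tendsto (fun n : ℕ => (1 + 1 / (n : ℝ)) ^ 2) atTop (𝓝 ((1 + 0) ^ 2)) :=
    (tendsto_const_nhds.add tendsto_one_div_atTop_nhds_zero_nat).pow 2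
  have h1 : ∀ᶠ n : ℕ in atTop, (1 + 1 / (n : ℝ)) ^ 2 < a :=
    (tendsto_order.1 h).2 a (by simpa using ha)
  filter_upwards [h1, eventually_gt_atTop 0] with n hn hn0
  have : (0 : ℝ) < n := by exact_mod_cast hn0
  push_cast
  calc ((n : ℝ) + 1) ^ 2 = (1 + 1 / (n : ℝ)) ^ 2 * (n : ℝ) ^ 2 := by field_simp
    _ ≤ a * (n : ℝ) ^ 2 := by gcongr

/-- Cesàro means of a bounded sequence converge to zero if they do so along the squares. -/
theorem tendsto_cesaro_of_tendsto_sq {x : ℕ → ℝ} {C : ℝ} (hx : ∀ s, |x s| ≤ C)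
    (h : Tendsto (fun n : ℕ => (((n ^ 2 : ℕ) : ℝ))⁻¹ * ∑ s ∈ Finset.range (n ^ 2), x s)
      atTop (𝓝 0)) :
    Tendsto (fun T : ℕ => (T : ℝ)⁻¹ * ∑ s ∈ Finset.range T, x s) atTop (𝓝 0) := by
  have hadd : ∀ T : ℕ, T ≠ 0 → (∑ s ∈ Finset.range T, (x s + C)) / T
      = (T : ℝ)⁻¹ * ∑ s ∈ Finset.range T, x s + C := by
    intro T hT
    rw [Finset.sum_add_distrib]
    simp only [Finset.sum_const, Finset.card_range, nsmul_eq_mul]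
    field_simp
  have key : Tendsto (fun T : ℕ => (∑ s ∈ Finset.range T, (x s + C)) / T) atTop (𝓝 C) := by
    -- Shifting by `C` makes the partial sums monotone, so the averages can be interpolated between
    -- consecutive squares, whose ratio tends to `1`.
    refine tendsto_div_of_monotone_of_exists_subseq_tendsto_div _ C ?_ fun a ha =>
      ⟨fun n => n ^ 2, eventually_succ_sq_le ha, tendsto_pow_atTop two_ne_zero, ?_⟩
    · refine monotone_nat_of_le_succ fun n => ?_
      rw [Finset.sum_range_succ]
      linarith [neg_le_of_abs_le (hx n)]
    · have := h.add_const C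
      rw [zero_add] at this
      refine this.congr' ?_
      filter_upwards [eventually_ne_atTop 0] with n hn
      exact (hadd _ (pow_ne_zero 2 hn)).symm
  have := key.sub_const C
  rw [sub_self] at this
  refine this.congr' ?_
  filter_upwards [eventually_ne_atTop 0] with n hn
  rw [hadd n hn]; ring

variable {Ω : Type*} [MeasurableSpace Ω] {P : Measure Ω} [IsProbabilityMeasure P]

/-- Each new term contributes one diagonal correlation and twice a sum of correlations over distinct
lags, hence the factor `3`. -/
theorem integral_sq_sum_le {ξ : ℕ → Ω → ℝ} {C : ℝ} {r : ℕ → ℝ} (hξ : ∀ s, Measurable (ξ s))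
    (hC : ∀ s ω, |ξ s ω| ≤ C) (hr : Summable r)
    (hcorr : ∀ s j, |∫ ω, ξ s ω * ξ (s + j) ω ∂P| ≤ r j) (T : ℕ) :
    ∫ ω, (∑ s ∈ Finset.range T, ξ s ω) ^ 2 ∂P ≤ 3 * (∑' j, r j) * T := by
  have hr0 : ∀ j, 0 ≤ r j := fun j => (abs_nonneg _).trans (hcorr 0 j)
  have hmem : ∀ s, MemLp (ξ s) 2 P := fun s =>
    memLp_of_bounded (a := -C) (b := C) (Eventually.of_forall fun ω => abs_le.1 (hC s ω))
      (hξ s).aestronglyMeasurable 2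
  have hmul : ∀ s t, Integrable (fun ω => ξ s ω * ξ t ω) P := fun s t =>
    (hmem s).integrable_mul (hmem t)
  induction T with
  | zero => simp
  | succ T ih =>
    have hS : MemLp (fun ω => ∑ s ∈ Finset.range T, ξ s ω) 2 P :=
      memLp_finsetSum _ fun s _ => hmem s
    have e : ∀ ω, (∑ s ∈ Finset.range (T + 1), ξ s ω) ^ 2 =
        (∑ s ∈ Finset.range T, ξ s ω) ^ 2 +
          (2 * ∑ s ∈ Finset.range T, ξ s ω * ξ T ω + ξ T ω * ξ T ω) := by
      intro ω
      rw [Finset.sum_range_succ, ← Finset.sum_mul]; ring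
    have hi2 : Integrable (fun ω => ∑ s ∈ Finset.range T, ξ s ω * ξ T ω) P :=
      integrable_finsetSum _ fun s _ => hmul s T
    have hi3 : Integrable (fun ω => 2 * ∑ s ∈ Finset.range T, ξ s ω * ξ T ω + ξ T ω * ξ T ω) P :=
      (hi2.const_mul 2).add (hmul T T)
    simp only [e]
    rw [integral_add hS.integrable_sq hi3,
      integral_add (hi2.const_mul 2) (hmul T T), integral_const_mul,
      integral_finsetSum _ fun s _ => hmul s T]
    have h1 : ∑ s ∈ Finset.range T, ∫ ω, ξ s ω * ξ T ω ∂P ≤ ∑' j, r j := by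
      calc ∑ s ∈ Finset.range T, ∫ ω, ξ s ω * ξ T ω ∂P
          ≤ ∑ s ∈ Finset.range T, r (T - 1 - s + 1) := by
            refine Finset.sum_le_sum fun s hs => ?_
            have hs' := Finset.mem_range.1 hs
            have := (le_abs_self _).trans (hcorr s (T - 1 - s + 1))
            rwa [show s + (T - 1 - s + 1) = T by omega] at this
        _ = ∑ j ∈ Finset.range T, r (j + 1) := Finset.sum_range_reflect (fun j => r (j + 1)) T
        _ ≤ ∑ j ∈ Finset.range (T + 1), r j := by
            rw [Finset.sum_range_succ']; linarith [hr0 0]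
        _ ≤ ∑' j, r j := hr.sum_le_tsum _ fun j _ => hr0 j
    have h2 : ∫ ω, ξ T ω * ξ T ω ∂P ≤ ∑' j, r j :=
      ((le_abs_self _).trans (hcorr T 0)).trans (hr.le_tsum 0 fun j _ => hr0 j)
    push_cast
    linarith

/-- A strong law of large numbers for bounded variables with summable correlations. -/
theorem ae_tendsto_cesaro_of_summable_correlation {ξ : ℕ → Ω → ℝ} {C : ℝ} {r : ℕ → ℝ}
    (hξ : ∀ s, Measurable (ξ s)) (hC : ∀ s ω, |ξ s ω| ≤ C) (hr : Summable r)
    (hcorr : ∀ s j, |∫ ω, ξ s ω * ξ (s + j) ω ∂P| ≤ r j) :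
    ∀ᵐ ω ∂P, Tendsto (fun T : ℕ => (T : ℝ)⁻¹ * ∑ s ∈ Finset.range T, ξ s ω) atTop (𝓝 0) := by
  -- Along squares the averages have second moment `O(1 / n ^ 2)`, which is summable. So the series
  -- of their squares is almost surely finite and its terms tend to zero.
  set A : ℕ → Ω → ℝ := fun n ω => (((n ^ 2 : ℕ) : ℝ))⁻¹ * ∑ s ∈ Finset.range (n ^ 2), ξ s ω
  have hA : ∀ n, Measurable (A n) := fun n =>
    (Finset.measurable_sum _ fun s _ => hξ s).const_mul _
  set R := ∑' j, r j
  have hint : ∀ n, ∫⁻ ω, ENNReal.ofReal (A n ω ^ 2) ∂P ≤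
      ENNReal.ofReal (3 * R * (1 / (n : ℝ) ^ 2)) := by
    intro n
    have hmem : MemLp (fun ω => ∑ s ∈ Finset.range (n ^ 2), ξ s ω) 2 P :=
      memLp_finsetSum _ fun s _ =>
        memLp_of_bounded (a := -C) (b := C) (Eventually.of_forall fun ω => abs_le.1 (hC s ω))
          (hξ s).aestronglyMeasurable 2
    rw [← ofReal_integral_eq_lintegral_ofReal (hmem.const_mul _).integrable_sq
      (Eventually.of_forall fun ω => sq_nonneg _)]
    refine ENNReal.ofReal_le_ofReal ?_
    simp only [mul_pow]
    rw [integral_const_mul]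
    refine (mul_le_mul_of_nonneg_left (integral_sq_sum_le hξ hC hr hcorr (n ^ 2))
      (by positivity)).trans (le_of_eq ?_)
    rcases eq_or_ne n 0 with rfl | hn
    · simp
    · have : (n : ℝ) ≠ 0 := by exact_mod_cast hn
      push_cast
      field_simp
      rfl
  have hsum : ∫⁻ ω, ∑' n, ENNReal.ofReal (A n ω ^ 2) ∂P ≠ ∞ := by
    rw [lintegral_tsum fun n => ((hA n).pow_const 2).ennreal_ofReal.aemeasurable]
    refine ne_top_of_le_ne_top ?_ (ENNReal.tsum_le_tsum hint)
    exact ((Real.summable_one_div_nat_pow.2 one_lt_two).mul_left (3 * R)).tsum_ofReal_ne_top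
  filter_upwards [ae_lt_top (Measurable.tsum fun n => ((hA n).pow_const 2).ennreal_ofReal)
    hsum] with ω hω
  refine tendsto_cesaro_of_tendsto_sq (fun s => hC s ω) ?_
  have h1 := ENNReal.tendsto_atTop_zero_of_tsum_ne_top hω.ne
  have h2 := (ENNReal.tendsto_toReal ENNReal.zero_ne_top).comp h1
  have h3 : Tendsto (fun n => A n ω ^ 2) atTop (𝓝 0) := by
    refine h2.congr fun n => ?_
    simp [ENNReal.toReal_ofReal (sq_nonneg (A n ω))]
  have h4 := h3.sqrt
  simp only [Real.sqrt_sq_eq_abs, Real.sqrt_zero] at h4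
  exact (tendsto_zero_iff_abs_tendsto_zero _).2 h4

/-- If `a` is approximated by sequences `b k` whose Cesàro means converge to `c k`, then `c` is
Cauchy, and the Cesàro means of `a` converge to its limit. -/
theorem tendsto_cesaro_of_approx {a : ℕ → ℝ} {b : ℕ → ℕ → ℝ} {c δ : ℕ → ℝ}
    (hδ : Tendsto δ atTop (𝓝 0)) (hab : ∀ k s, k ≤ s → |a s - b k s| ≤ δ k)
    (hb : ∀ k, Tendsto (fun T : ℕ => (T : ℝ)⁻¹ * ∑ s ∈ Finset.range T, b k s) atTop (𝓝 (c k))) :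
    CauchySeq c ∧ ∀ l, Tendsto c atTop (𝓝 l) →
      Tendsto (fun T : ℕ => (T : ℝ)⁻¹ * ∑ s ∈ Finset.range T, a s) atTop (𝓝 l) := by
  have hδ0 : ∀ k, 0 ≤ δ k := fun k => (abs_nonneg _).trans (hab k k le_rfl)
  obtain ⟨B, hB, hAB⟩ : ∃ B : ℕ → ℕ → ℝ, (∀ k, Tendsto (B k) atTop (𝓝 (c k))) ∧
      ∀ (k T : ℕ), |(T : ℝ)⁻¹ * ∑ s ∈ Finset.range T, a s - B k T| ≤ δ k := by
    -- Splicing `a` before time `k` with `b k` afterwards gives an approximation valid at every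
    -- time; the finitely many changed terms do not affect the Cesàro limit.
    refine ⟨fun k T => (T : ℝ)⁻¹ * ∑ s ∈ Finset.range T, if s < k then a s else b k s,
      fun k => ?_, fun k T => ?_⟩
    · have hd : Tendsto (fun s => if s < k then a s - b k s else 0) atTop (𝓝 0) := by
        refine tendsto_const_nhds.congr' ?_
        filter_upwards [eventually_ge_atTop k] with s hs
        rw [if_neg (not_lt.2 hs)]
      have := (hb k).add hd.cesaro
      rw [add_zero] at this
      refine this.congr fun T => ?_
      rw [← mul_add, ← Finset.sum_add_distrib]
      congr 1
      refine Finset.sum_congr rfl fun s _ => ?_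
      split_ifs <;> ring
    · rw [← mul_sub, ← Finset.sum_sub_distrib, abs_mul,
        abs_of_nonneg (by positivity : (0 : ℝ) ≤ (T : ℝ)⁻¹)]
      rcases eq_or_ne T 0 with rfl | hT
      · simpa using hδ0 k
      rw [inv_mul_le_iff₀ (by positivity)]
      refine (Finset.abs_sum_le_sum_abs _ _).trans ?_
      refine (Finset.sum_le_sum (g := fun _ => δ k) fun s _ => ?_).trans (by simp)
      split_ifs with h
      · simpa using hδ0 k
      · exact hab k s (not_lt.1 h)
  have hdist : ∀ k j, |c k - c j| ≤ δ k + δ j := fun k j => by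
    refine le_of_tendsto ((hB k).sub (hB j)).abs (Eventually.of_forall fun T => ?_)
    have := abs_sub_le (B k T) ((T : ℝ)⁻¹ * ∑ s ∈ Finset.range T, a s) (B j T)
    have h1 := hAB k T
    rw [abs_sub_comm] at h1
    linarith [hAB j T]
  refine ⟨Metric.cauchySeq_iff'.2 fun η hη => ?_, fun l hl => Metric.tendsto_atTop.2 fun η hη => ?_⟩
  · obtain ⟨N, hN⟩ := eventually_atTop.1 ((tendsto_order.1 hδ).2 (η / 2) (half_pos hη))
    refine ⟨N, fun n hn => ?_⟩
    rw [Real.dist_eq]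
    linarith [hdist n N, hN n hn, hN N le_rfl]
  · obtain ⟨k, hk, hkl⟩ := (((tendsto_order.1 hδ).2 (η / 3) (by positivity)).and
      (Metric.tendsto_nhds.1 hl (η / 3) (by positivity))).exists
    obtain ⟨N, hN⟩ := eventually_atTop.1 (Metric.tendsto_nhds.1 (hB k) (η / 3) (by positivity))
    refine ⟨N, fun T hT => ?_⟩
    have h1 := hN T hT
    have h2 := hAB k T
    rw [Real.dist_eq] at *
    have h3 := abs_sub_le ((T : ℝ)⁻¹ * ∑ s ∈ Finset.range T, a s) (B k T) l
    have h4 := abs_sub_le (B k T) (c k) l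
    linarith

end LawOfLargeNumbers

/-! ### Closure properties of bounded measurable functions. -/

section BoundedMeasurable

/-- Bounded measurable real-valued functions. -/
def BddMeasurable {α : Type*} [MeasurableSpace α] (f : α → ℝ) : Prop :=
  Measurable f ∧ ∃ C, ∀ x, |f x| ≤ C

variable {α : Type*} [MeasurableSpace α] {f g : α → ℝ}

theorem BddMeasurable.of_mem_Icc (hf : Measurable f) {a b : ℝ} (h : ∀ x, f x ∈ Set.Icc a b) :
    BddMeasurable f :=
  ⟨hf, max |a| |b|, fun x => abs_le_max_abs_abs (h x).1 (h x).2⟩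

theorem BddMeasurable.integrable (hf : BddMeasurable f) {μ : Measure α} [IsFiniteMeasure μ] :
    Integrable f μ := by
  obtain ⟨hm, C, hC⟩ := hf
  exact Integrable.of_bound hm.aestronglyMeasurable C (Eventually.of_forall hC)

theorem BddMeasurable.mul (hf : BddMeasurable f) (hg : BddMeasurable g) :
    BddMeasurable fun x => f x * g x := by
  obtain ⟨hfm, C, hC⟩ := hf
  obtain ⟨hgm, D, hD⟩ := hg
  refine ⟨hfm.mul hgm, C * D, fun x => ?_⟩
  rw [abs_mul]
  exact mul_le_mul (hC x) (hD x) (abs_nonneg _) ((abs_nonneg _).trans (hC x))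

theorem BddMeasurable.const (c : ℝ) : BddMeasurable fun _ : α => c :=
  ⟨measurable_const, |c|, fun _ => le_rfl⟩

theorem BddMeasurable.sub (hf : BddMeasurable f) (hg : BddMeasurable g) :
    BddMeasurable fun x => f x - g x := by
  obtain ⟨hfm, C, hC⟩ := hf
  obtain ⟨hgm, D, hD⟩ := hg
  exact ⟨hfm.sub hgm, C + D, fun x => (abs_sub _ _).trans (add_le_add (hC x) (hD x))⟩

theorem BddMeasurable.comp {β : Type*} [MeasurableSpace β] (hf : BddMeasurable f) {φ : β → α}
    (hφ : Measurable φ) : BddMeasurable fun x => f (φ x) :=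
  ⟨hf.1.comp hφ, hf.2.imp fun _ h _ => h _⟩

end BoundedMeasurable

/-! ### The filter: one-step recursion, measurability in the observations, normalisation. -/

namespace StateSpaceModel

variable {X Y : Type*} [MeasurableSpace X] [MeasurableSpace Y] {lX : Measure X} {lY : Measure Y}

/-- The densities of a state-space model lie between `ε` and `ε⁻¹`. -/
structure StronglyMixing (S : StateSpaceModel lX lY) (ε : ℝ) : Prop where
  pos : 0 < ε
  lt_one : ε < 1
  le_m : ∀ x x', ε ≤ (S.m x x' : ℝ)
  m_le : ∀ x x', (S.m x x' : ℝ) ≤ ε⁻¹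
  le_g : ∀ x y, ε ≤ (S.g x y : ℝ)
  g_le : ∀ x y, (S.g x y : ℝ) ≤ ε⁻¹

/-- Integrating `ε ≤ m x x'` in `x'` gives `ε * lX univ ≤ 1`. -/
theorem isFiniteMeasure_of_le (S : StateSpaceModel lX lY) [Nonempty X] {ε : ℝ} (hε : 0 < ε)
    (h : ∀ x x', ε ≤ (S.m x x' : ℝ)) : IsFiniteMeasure lX := by
  obtain ⟨x⟩ := ‹Nonempty X›
  have h1 : ENNReal.ofReal ε * lX Set.univ ≤ 1 := by
    rw [← S.lintegral_m x, ← setLIntegral_univ, ← setLIntegral_const]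
    refine lintegral_mono fun x' => ?_
    rw [← ENNReal.ofReal_coe_nnreal]
    exact ENNReal.ofReal_le_ofReal (h x x')
  constructor
  by_contra hc
  rw [not_lt, top_le_iff] at hc
  rw [hc, ENNReal.mul_top (by simpa using hε)] at h1
  simp at h1

theorem integral_m (S : StateSpaceModel lX lY) (x : X) : ∫ x', (S.m x x' : ℝ) ∂lX = 1 := by
  rw [integral_eq_lintegral_of_nonneg_ae (Eventually.of_forall fun _ => NNReal.coe_nonneg _)
    (S.measurable_m.of_uncurry_left.coe_nnreal_real).aestronglyMeasurable]
  simp [S.lintegral_m]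

section Recursion

variable [SigmaFinite lX]

omit [SigmaFinite lX] in
theorem measurable_jointDensity (S : StateSpaceModel lX lY) {m₀ : X → ℝ≥0} (hm₀ : Measurable m₀)
    (t : ℕ) : Measurable fun p : (Fin (t + 1) → X) × (ℕ → Y) => S.jointDensity m₀ t p.1 p.2 := by
  have hx : ∀ i : Fin (t + 1), Measurable fun p : (Fin (t + 1) → X) × (ℕ → Y) => p.1 i :=
    fun i => by fun_prop
  have hy : ∀ i : ℕ, Measurable fun p : (Fin (t + 1) → X) × (ℕ → Y) => p.2 i :=
    fun i => by fun_prop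
  refine ((hm₀.comp (hx 0)).mul (S.measurable_g.comp ((hx 0).prodMk (hy 0)))).mul
    (Finset.measurable_prod _ fun s _ => ?_)
  exact (S.measurable_m.comp ((hx _).prodMk (hx _))).mul
    (S.measurable_g.comp ((hx _).prodMk (hy _)))

theorem lintegral_unnormalizedFilter (S : StateSpaceModel lX lY) {m₀ : X → ℝ≥0}
    (hm₀ : Measurable m₀) (t : ℕ) (y : ℕ → Y) {f : X → ℝ≥0∞} (hf : Measurable f) :
    ∫⁻ x, f x ∂(S.unnormalizedFilter m₀ t y) =
      ∫⁻ x, S.jointDensity m₀ t x y * f (x (Fin.last t)) ∂(Measure.pi fun _ => lX) := by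
  have hJ : Measurable fun x => (S.jointDensity m₀ t x y : ℝ≥0∞) :=
    ((S.measurable_jointDensity hm₀ t).comp measurable_prodMk_right).coe_nnreal_ennreal
  have hf' : Measurable fun x : Fin (t + 1) → X => f (x (Fin.last t)) :=
    hf.comp (measurable_pi_apply _)
  rw [unnormalizedFilter, lintegral_map hf (measurable_pi_apply _),
    lintegral_withDensity_eq_lintegral_mul _ hJ hf']
  rfl

omit [SigmaFinite lX] in
theorem jointDensity_snoc (S : StateSpaceModel lX lY) (m₀ : X → ℝ≥0) (t : ℕ) (y : ℕ → Y)
    (x : Fin (t + 1) → X) (x' : X) :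
    S.jointDensity m₀ (t + 1) (Fin.snoc x x' : Fin (t + 2) → X) y =
      S.jointDensity m₀ t x y * (S.m (x (Fin.last t)) x' * S.g x' (y (t + 1))) := by
  have h0 : (Fin.snoc x x' : Fin (t + 2) → X) 0 = x 0 := Fin.snoc_castSucc (α := fun _ => X) x' x 0
  have h1 : ∀ i : Fin (t + 1), (Fin.snoc x x' : Fin (t + 2) → X) i.castSucc = x i :=
    fun i => Fin.snoc_castSucc (α := fun _ => X) x' x i
  have h2 : (Fin.snoc x x' : Fin (t + 2) → X) (Fin.last t).succ = x' :=
    Fin.snoc_last (α := fun _ => X) x' x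
  simp only [jointDensity, Fin.prod_univ_castSucc, h0, h1, h2, Fin.succ_castSucc, Fin.val_castSucc,
    Fin.val_last]
  ring

/-- The unnormalised transition kernel `m(x, x') g(x', y) lX(dx')`. -/
noncomputable def updateKernel (S : StateSpaceModel lX lY) (y : Y) : Kernel X X :=
  Kernel.withDensity (Kernel.const X lX) (fun x x' => ((S.m x x' * S.g x' y : ℝ≥0) : ℝ≥0∞))

omit [SigmaFinite lX] in
theorem measurable_updateDensity (S : StateSpaceModel lX lY) (y : Y) :
    Measurable (Function.uncurry fun x x' => S.m x x' * S.g x' y) :=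
  S.measurable_m.mul (S.measurable_g.comp (measurable_snd.prodMk measurable_const))

theorem updateKernel_apply (S : StateSpaceModel lX lY) (y : Y) (x : X) :
    S.updateKernel y x = lX.withDensity fun x' => ((S.m x x' * S.g x' y : ℝ≥0) : ℝ≥0∞) := by
  rw [updateKernel, Kernel.withDensity_apply _ (S.measurable_updateDensity y).coe_nnreal_ennreal,
    Kernel.const_apply]

/-- Integrating the last path coordinate separately turns the path-space definition into a linear
recursion on measures on `X`. -/
theorem unnormalizedFilter_succ (S : StateSpaceModel lX lY) {m₀ : X → ℝ≥0} (hm₀ : Measurable m₀)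
    (t : ℕ) (y : ℕ → Y) :
    S.unnormalizedFilter m₀ (t + 1) y =
      (S.unnormalizedFilter m₀ t y).bind (S.updateKernel (y (t + 1))) := by
  ext A hA
  have hq := (S.measurable_updateDensity (y (t + 1))).coe_nnreal_ennreal
  rw [Measure.bind_apply hA (Kernel.measurable _).aemeasurable,
    lintegral_unnormalizedFilter S hm₀ t y (Kernel.measurable_coe _ hA),
    ← lintegral_indicator_one hA,
    lintegral_unnormalizedFilter S hm₀ (t + 1) y (measurable_one.indicator hA)]
  have hmp := (measurePreserving_piFinSuccAbove (fun _ : Fin (t + 2) => lX) (Fin.last (t + 1))).symm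
  rw [← hmp.lintegral_comp_emb (MeasurableEquiv.measurableEmbedding _)]
  have hmeas : Measurable fun p : X × (Fin (t + 1) → X) =>
      (S.jointDensity m₀ t p.2 y : ℝ≥0∞) *
        (((S.m (p.2 (Fin.last t)) p.1 * S.g p.1 (y (t + 1)) : ℝ≥0) : ℝ≥0∞) *
          A.indicator 1 p.1) := by
    refine Measurable.mul ?_ (Measurable.mul ?_ ?_)
    · exact ((S.measurable_jointDensity hm₀ t).comp
        (measurable_snd.prodMk measurable_const)).coe_nnreal_ennreal
    · have : Measurable fun p : X × (Fin (t + 1) → X) => (p.2 (Fin.last t), p.1) := by fun_prop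
      exact hq.comp this
    · exact (measurable_one.indicator hA).comp measurable_fst
  calc _ = ∫⁻ p : X × (Fin (t + 1) → X), (S.jointDensity m₀ t p.2 y : ℝ≥0∞) *
        (((S.m (p.2 (Fin.last t)) p.1 * S.g p.1 (y (t + 1)) : ℝ≥0) : ℝ≥0∞) *
          A.indicator 1 p.1) ∂(lX.prod (Measure.pi fun _ => lX)) := by
        refine lintegral_congr fun p => ?_
        have e : (MeasurableEquiv.piFinSuccAbove (fun _ : Fin (t + 2) => X)
            (Fin.last (t + 1))).symm p = (Fin.snoc p.2 p.1 : Fin (t + 2) → X) :=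
          Fin.insertNth_last' p.1 p.2
        have e2 : (Fin.snoc p.2 p.1 : Fin (t + 2) → X) (Fin.last (t + 1)) = p.1 :=
          Fin.snoc_last (α := fun _ => X) _ _
        rw [e, jointDensity_snoc, e2, ENNReal.coe_mul, mul_assoc]
    _ = ∫⁻ x : Fin (t + 1) → X, ∫⁻ x', (S.jointDensity m₀ t x y : ℝ≥0∞) *
        (((S.m (x (Fin.last t)) x' * S.g x' (y (t + 1)) : ℝ≥0) : ℝ≥0∞) *
          A.indicator 1 x') ∂lX ∂(Measure.pi fun _ => lX) :=
        lintegral_prod_symm _ hmeas.aemeasurable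
    _ = _ := by
        refine lintegral_congr fun x => ?_
        rw [lintegral_const_mul' _ _ ENNReal.coe_ne_top, updateKernel_apply,
          withDensity_apply _ hA, ← lintegral_indicator hA]
        congr 1
        refine lintegral_congr fun x' => ?_
        by_cases h : x' ∈ A <;> simp [h]

theorem unnormalizedFilter_zero (S : StateSpaceModel lX lY) {m₀ : X → ℝ≥0} (hm₀ : Measurable m₀)
    (y : ℕ → Y) :
    S.unnormalizedFilter m₀ 0 y =
      lX.withDensity fun x => ((m₀ x * S.g x (y 0) : ℝ≥0) : ℝ≥0∞) := by
  ext A hA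
  rw [← lintegral_indicator_one hA,
    lintegral_unnormalizedFilter S hm₀ 0 y (measurable_one.indicator hA),
    withDensity_apply _ hA, ← lintegral_indicator hA]
  refine (((measurePreserving_funUnique lX (Fin 1)).symm).lintegral_comp_emb
      (MeasurableEquiv.measurableEmbedding _) _).symm.trans ?_
  refine lintegral_congr fun x => ?_
  by_cases h : x ∈ A <;> simp [h, jointDensity]

theorem measurable_unnormalizedFilter (S : StateSpaceModel lX lY) {m₀ : X → ℝ≥0}
    (hm₀ : Measurable m₀) (t : ℕ) : Measurable (S.unnormalizedFilter m₀ t) := by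
  refine Measure.measurable_of_measurable_coe _ fun A hA => ?_
  have h : ∀ y, S.unnormalizedFilter m₀ t y A = ∫⁻ x, S.jointDensity m₀ t x y *
      A.indicator 1 (x (Fin.last t)) ∂(Measure.pi fun _ => lX) := fun y => by
    rw [← lintegral_indicator_one hA,
      lintegral_unnormalizedFilter S hm₀ t y (measurable_one.indicator hA)]
  simp only [h]
  refine Measurable.lintegral_prod_left' (f := fun p : (Fin (t + 1) → X) × (ℕ → Y) =>
    (S.jointDensity m₀ t p.1 p.2 : ℝ≥0∞) * A.indicator 1 (p.1 (Fin.last t))) ?_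
  exact (S.measurable_jointDensity hm₀ t).coe_nnreal_ennreal.mul
    ((measurable_one.indicator hA).comp ((measurable_pi_apply _).comp measurable_fst))

theorem measurable_filter (S : StateSpaceModel lX lY) {m₀ : X → ℝ≥0}
    (hm₀ : Measurable m₀) (t : ℕ) : Measurable (S.filter m₀ t) := by
  have h := S.measurable_unnormalizedFilter hm₀ t
  refine Measure.measurable_of_measurable_coe _ fun A hA => ?_
  simp only [filter, Measure.smul_apply, smul_eq_mul]
  exact ((Measure.measurable_coe .univ).comp h).inv.mul ((Measure.measurable_coe hA).comp h)

end Recursion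

section Mass

variable [SigmaFinite lX] {S : StateSpaceModel lX lY} {ε : ℝ} {m₀ : X → ℝ≥0}

theorem StronglyMixing.mass_zero (hS : S.StronglyMixing ε) (hm₀ : Measurable m₀)
    (hm₀_one : ∫⁻ x, (m₀ x : ℝ≥0∞) ∂lX = 1) (y : ℕ → Y) :
    S.unnormalizedFilter m₀ 0 y Set.univ ∈
      Set.Icc (ENNReal.ofReal ε) (ENNReal.ofReal ε⁻¹) := by
  rw [unnormalizedFilter_zero S hm₀, withDensity_apply _ .univ, setLIntegral_univ]
  have h : ∀ c : ℝ, ∫⁻ x, (m₀ x : ℝ≥0∞) * ENNReal.ofReal c ∂lX = ENNReal.ofReal c := fun c => by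
    rw [lintegral_mul_const' _ _ ENNReal.ofReal_ne_top, hm₀_one, one_mul]
  constructor
  · rw [← h ε]
    refine lintegral_mono fun x => ?_
    rw [ENNReal.coe_mul, ← ENNReal.ofReal_coe_nnreal (p := S.g x (y 0))]
    gcongr
    exact hS.le_g _ _
  · rw [← h ε⁻¹]
    refine lintegral_mono fun x => ?_
    rw [ENNReal.coe_mul, ← ENNReal.ofReal_coe_nnreal (p := S.g x (y 0))]
    gcongr
    exact hS.g_le _ _

theorem StronglyMixing.updateKernel_mass (hS : S.StronglyMixing ε) (y : Y) (x : X) :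
    S.updateKernel y x Set.univ ∈ Set.Icc (ENNReal.ofReal ε) (ENNReal.ofReal ε⁻¹) := by
  rw [updateKernel_apply, withDensity_apply _ .univ, setLIntegral_univ]
  have h : ∀ c : ℝ, ∫⁻ x', (S.m x x' : ℝ≥0∞) * ENNReal.ofReal c ∂lX = ENNReal.ofReal c := fun c => by
    rw [lintegral_mul_const' _ _ ENNReal.ofReal_ne_top, S.lintegral_m, one_mul]
  constructor
  · rw [← h ε]
    refine lintegral_mono fun x' => ?_
    rw [ENNReal.coe_mul, ← ENNReal.ofReal_coe_nnreal (p := S.g x' y)]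
    gcongr
    exact hS.le_g _ _
  · rw [← h ε⁻¹]
    refine lintegral_mono fun x' => ?_
    rw [ENNReal.coe_mul, ← ENNReal.ofReal_coe_nnreal (p := S.g x' y)]
    gcongr
    exact hS.g_le _ _

theorem StronglyMixing.mass_ne (hS : S.StronglyMixing ε) (hm₀ : Measurable m₀)
    (hm₀_one : ∫⁻ x, (m₀ x : ℝ≥0∞) ∂lX = 1) (t : ℕ) (y : ℕ → Y) :
    S.unnormalizedFilter m₀ t y Set.univ ≠ 0 ∧ S.unnormalizedFilter m₀ t y Set.univ ≠ ∞ := by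
  have hε : ENNReal.ofReal ε ≠ 0 := by simpa using hS.pos
  induction t with
  | zero =>
    obtain ⟨h1, h2⟩ := hS.mass_zero hm₀ hm₀_one y
    exact ⟨((pos_iff_ne_zero.2 hε).trans_le h1).ne', ne_top_of_le_ne_top ENNReal.ofReal_ne_top h2⟩
  | succ t ih =>
    rw [unnormalizedFilter_succ S hm₀, Measure.bind_apply .univ (Kernel.measurable _).aemeasurable]
    constructor
    · have : ENNReal.ofReal ε * S.unnormalizedFilter m₀ t y Set.univ ≤
          ∫⁻ x, S.updateKernel (y (t + 1)) x Set.univ ∂(S.unnormalizedFilter m₀ t y) := by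
        rw [← lintegral_const]
        exact lintegral_mono fun x => (hS.updateKernel_mass _ x).1
      exact ((pos_iff_ne_zero.2 (mul_ne_zero hε ih.1)).trans_le this).ne'
    · have : ∫⁻ x, S.updateKernel (y (t + 1)) x Set.univ ∂(S.unnormalizedFilter m₀ t y) ≤
          ENNReal.ofReal ε⁻¹ * S.unnormalizedFilter m₀ t y Set.univ := by
        rw [← lintegral_const]
        exact lintegral_mono fun x => (hS.updateKernel_mass _ x).2
      exact ne_top_of_le_ne_top (ENNReal.mul_ne_top ENNReal.ofReal_ne_top ih.2) this

theorem StronglyMixing.isProbabilityMeasure_filter (hS : S.StronglyMixing ε) (hm₀ : Measurable m₀)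
    (hm₀_one : ∫⁻ x, (m₀ x : ℝ≥0∞) ∂lX = 1) (t : ℕ) (y : ℕ → Y) :
    IsProbabilityMeasure (S.filter m₀ t y) := by
  obtain ⟨h1, h2⟩ := hS.mass_ne hm₀ hm₀_one t y
  exact ⟨by rw [filter, Measure.smul_apply, smul_eq_mul, ENNReal.inv_mul_cancel h1 h2]⟩

theorem StronglyMixing.isFiniteMeasure_unnormalizedFilter (hS : S.StronglyMixing ε)
    (hm₀ : Measurable m₀) (hm₀_one : ∫⁻ x, (m₀ x : ℝ≥0∞) ∂lX = 1) (t : ℕ) (y : ℕ → Y) :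
    IsFiniteMeasure (S.unnormalizedFilter m₀ t y) :=
  ⟨(hS.mass_ne hm₀ hm₀_one t y).2.lt_top⟩

/-- The normaliser is written as an integral of `1` so that numerator and denominator evolve under
the same linear operator. -/
theorem integral_filter (S : StateSpaceModel lX lY) (m₀ : X → ℝ≥0) (t : ℕ) (y : ℕ → Y)
    (f : X → ℝ) :
    ∫ x, f x ∂(S.filter m₀ t y) = (∫ x, f x ∂(S.unnormalizedFilter m₀ t y)) /
      ∫ _x, (1 : ℝ) ∂(S.unnormalizedFilter m₀ t y) := by
  rw [filter, integral_smul_measure, ENNReal.toReal_inv, smul_eq_mul, inv_mul_eq_div]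
  simp [Measure.real]

end Mass

end StateSpaceModel

/-! ### Contraction of ratios under the filtering operators, and forgetting of the filter. -/

namespace StateSpaceModel

variable {X Y : Type*} [MeasurableSpace X] [MeasurableSpace Y] {lX : Measure X} {lY : Measure Y}

/-- The operator `f ↦ ∫ m(x, x') g(x', y) f(x') lX(dx')`. -/
noncomputable def propagate (S : StateSpaceModel lX lY) (y : Y) (f : X → ℝ) (x : X) : ℝ :=
  ∫ x', (S.m x x' : ℝ) * (S.g x' y : ℝ) * f x' ∂lX

/-- The composition of the operators `propagate` at the observations `y 1, …, y k`. -/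
noncomputable def iterPropagate (S : StateSpaceModel lX lY) (y : ℕ → Y) : ℕ → (X → ℝ) → X → ℝ
  | 0, f => f
  | k + 1, f => iterPropagate S y k (S.propagate (y (k + 1)) f)

theorem iterPropagate_congr (S : StateSpaceModel lX lY) {y y' : ℕ → Y} (k : ℕ)
    (h : ∀ i < k, y (i + 1) = y' (i + 1)) (f : X → ℝ) :
    S.iterPropagate y k f = S.iterPropagate y' k f := by
  induction k generalizing f with
  | zero => rfl
  | succ k ih =>
    rw [iterPropagate, iterPropagate, h k (Nat.lt_succ_self k),
      ih fun i hi => h i (hi.trans (Nat.lt_succ_self k))]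

variable {S : StateSpaceModel lX lY} {ε : ℝ}

theorem StronglyMixing.bdd_g (hS : S.StronglyMixing ε) (y : Y) :
    BddMeasurable fun x => (S.g x y : ℝ) :=
  .of_mem_Icc (S.measurable_g.comp measurable_prodMk_right).coe_nnreal_real
    fun x => ⟨hS.le_g x y, hS.g_le x y⟩

theorem StronglyMixing.bdd_m (hS : S.StronglyMixing ε) (x : X) :
    BddMeasurable fun x' => (S.m x x' : ℝ) :=
  .of_mem_Icc S.measurable_m.of_uncurry_left.coe_nnreal_real
    fun x' => ⟨hS.le_m x x', hS.m_le x x'⟩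

theorem StronglyMixing.bdd_propagate [IsFiniteMeasure lX] (hS : S.StronglyMixing ε) (y : Y)
    {f : X → ℝ} (hf : BddMeasurable f) : BddMeasurable (S.propagate y f) := by
  constructor
  · have : Measurable (Function.uncurry fun x x' => (S.m x x' : ℝ) * (S.g x' y : ℝ) * f x') :=
      ((S.measurable_updateDensity y).coe_nnreal_real).mul (hf.1.comp measurable_snd)
    exact this.stronglyMeasurable.integral_prod_right.measurable
  · obtain ⟨C, hC⟩ := hf.2
    refine ⟨ε⁻¹ * ε⁻¹ * C * lX.real Set.univ, fun x => ?_⟩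
    suffices h : ∀ x', ‖(S.m x x' : ℝ) * (S.g x' y : ℝ) * f x'‖ ≤ ε⁻¹ * ε⁻¹ * C from
      norm_integral_le_of_norm_le_const (μ := lX) (Eventually.of_forall h)
    intro x'
    rw [norm_mul, norm_mul, Real.norm_eq_abs, Real.norm_eq_abs, Real.norm_eq_abs,
      NNReal.abs_eq, NNReal.abs_eq]
    have h1 := hS.m_le x x'
    have h2 := hS.g_le x' y
    have := hS.pos
    gcongr
    exact hC x'

theorem StronglyMixing.propagate_pos [IsFiniteMeasure lX] (hS : S.StronglyMixing ε) (y : Y)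
    {v : X → ℝ} (hv : BddMeasurable v) {d : ℝ} (hd : 0 < d) (h : ∀ x, d ≤ v x) (x : X) :
    ε * d ≤ S.propagate y v x := by
  have h1 : ∫ x', (S.m x x' : ℝ) * (ε * d) ∂lX = ε * d := by
    rw [integral_mul_const, S.integral_m, one_mul]
  rw [← h1]
  refine integral_mono ((hS.bdd_m x).integrable.mul_const _)
    (((hS.bdd_m x).mul (hS.bdd_g y)).mul hv).integrable fun x' => ?_
  have h2 := hS.le_g x' y
  have := hS.pos
  rw [mul_assoc]
  dsimp only
  gcongr
  exact h x'

/-- A Birkhoff-type contraction. Let `c = J / I` be the mean of `u / v` under the weight `g * v`.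
From `m ≥ ε`, the excess of `propagate u` over `a * propagate v` is at least `ε * (c - a) * I`, and
from `m ≤ ε⁻¹`, `I ≥ ε * propagate v`. So the lower ratio rises by `ε ^ 2 * (c - a)`; symmetrically
the upper one falls by `ε ^ 2 * (b - c)`, and together these are `ε ^ 2 * (b - a)`. -/
theorem StronglyMixing.propagate_ratio [Nonempty X] [IsFiniteMeasure lX]
    (hS : S.StronglyMixing ε) (y : Y)
    {u v : X → ℝ} (hu : BddMeasurable u) (hv : BddMeasurable v) {d : ℝ} (hd : 0 < d)
    (hdv : ∀ x, d ≤ v x) {a b : ℝ} (ha : ∀ x, a * v x ≤ u x) (hb : ∀ x, u x ≤ b * v x) :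
    ∃ a' b', b' - a' = (1 - ε ^ 2) * (b - a) ∧
      (∀ x, a' * S.propagate y v x ≤ S.propagate y u x) ∧
      ∀ x, S.propagate y u x ≤ b' * S.propagate y v x := by
  have hε := hS.pos
  set I := ∫ x', (S.g x' y : ℝ) * v x' ∂lX
  set J := ∫ x', (S.g x' y : ℝ) * u x' ∂lX
  have hgu : Integrable (fun x' => (S.g x' y : ℝ) * u x') lX := ((hS.bdd_g y).mul hu).integrable
  have hgv : Integrable (fun x' => (S.g x' y : ℝ) * v x') lX := ((hS.bdd_g y).mul hv).integrable
  have hmu : ∀ x, Integrable (fun x' => (S.m x x' : ℝ) * (S.g x' y : ℝ) * u x') lX := fun x =>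
    (((hS.bdd_m x).mul (hS.bdd_g y)).mul hu).integrable
  have hmv : ∀ x, Integrable (fun x' => (S.m x x' : ℝ) * (S.g x' y : ℝ) * v x') lX := fun x =>
    (((hS.bdd_m x).mul (hS.bdd_g y)).mul hv).integrable
  have hIA : ∀ x, ε * S.propagate y v x ≤ I := fun x => by
    rw [propagate, ← integral_const_mul]
    refine integral_mono ((hmv x).const_mul _) hgv fun x' => ?_
    have h1 : ε * (S.m x x' : ℝ) ≤ 1 := by
      have := mul_le_mul_of_nonneg_left (hS.m_le x x') hε.le
      rwa [mul_inv_cancel₀ hε.ne'] at this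
    have h2 : 0 ≤ (S.g x' y : ℝ) * v x' :=
      mul_nonneg (NNReal.coe_nonneg _) (hd.le.trans (hdv x'))
    dsimp only
    nlinarith
  have hI : 0 < I := by
    obtain ⟨x⟩ := ‹Nonempty X›
    exact lt_of_lt_of_le (by have := hS.propagate_pos y hv hd hdv x; positivity)
      (le_trans (mul_le_mul_of_nonneg_left (hS.propagate_pos y hv hd hdv x) hε.le) (hIA x))
  have hJa : a * I ≤ J := by
    rw [← integral_const_mul]
    refine integral_mono (hgv.const_mul _) hgu fun x' => ?_
    have := mul_le_mul_of_nonneg_left (ha x') (NNReal.coe_nonneg (S.g x' y))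
    dsimp only
    linarith
  have hJb : J ≤ b * I := by
    rw [← integral_const_mul]
    refine integral_mono hgu (hgv.const_mul _) fun x' => ?_
    have := mul_le_mul_of_nonneg_left (hb x') (NNReal.coe_nonneg (S.g x' y))
    dsimp only
    linarith
  have hlow : ∀ x, ε * (J - a * I) ≤ S.propagate y u x - a * S.propagate y v x := fun x => by
    rw [propagate, propagate, ← integral_const_mul, ← integral_const_mul,
      ← integral_sub hgu (hgv.const_mul _), ← integral_sub (hmu x) ((hmv x).const_mul _),
      ← integral_const_mul]
    refine integral_mono ((hgu.sub (hgv.const_mul _)).const_mul _)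
      ((hmu x).sub ((hmv x).const_mul _)) fun x' => ?_
    have h1 : 0 ≤ (S.g x' y : ℝ) * (u x' - a * v x') :=
      mul_nonneg (NNReal.coe_nonneg _) (by linarith [ha x'])
    have := mul_le_mul_of_nonneg_right (hS.le_m x x') h1
    dsimp only
    linarith
  have hup : ∀ x, ε * (b * I - J) ≤ b * S.propagate y v x - S.propagate y u x := fun x => by
    rw [propagate, propagate, ← integral_const_mul, ← integral_const_mul,
      ← integral_sub (hgv.const_mul _) hgu, ← integral_sub ((hmv x).const_mul _) (hmu x),
      ← integral_const_mul]
    refine integral_mono (((hgv.const_mul _).sub hgu).const_mul _)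
      (((hmv x).const_mul _).sub (hmu x)) fun x' => ?_
    have h1 : 0 ≤ (S.g x' y : ℝ) * (b * v x' - u x') :=
      mul_nonneg (NNReal.coe_nonneg _) (by linarith [hb x'])
    have := mul_le_mul_of_nonneg_right (hS.le_m x x') h1
    dsimp only
    linarith
  set c := J / I
  have hJc : J = c * I := by simp only [c]; field_simp
  have hac : a ≤ c := by rw [hJc] at hJa; exact le_of_mul_le_mul_right hJa hI
  have hcb : c ≤ b := by rw [hJc] at hJb; exact le_of_mul_le_mul_right hJb hI
  refine ⟨a + ε ^ 2 * (c - a), b - ε ^ 2 * (b - c), by ring, fun x => ?_, fun x => ?_⟩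
  · have h1 := hlow x
    have h2 := mul_le_mul_of_nonneg_left (hIA x) (mul_nonneg hε.le (sub_nonneg.2 hac))
    rw [hJc] at h1
    nlinarith
  · have h1 := hup x
    have h2 := mul_le_mul_of_nonneg_left (hIA x) (mul_nonneg hε.le (sub_nonneg.2 hcb))
    rw [hJc] at h1
    nlinarith

theorem StronglyMixing.iterPropagate_ratio [Nonempty X] [IsFiniteMeasure lX]
    (hS : S.StronglyMixing ε) (y : ℕ → Y) (k : ℕ)
    {u v : X → ℝ} (hu : BddMeasurable u) (hv : BddMeasurable v) {d : ℝ} (hd : 0 < d)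
    (hdv : ∀ x, d ≤ v x) {a b : ℝ} (ha : ∀ x, a * v x ≤ u x) (hb : ∀ x, u x ≤ b * v x) :
    ∃ a' b', b' - a' = (1 - ε ^ 2) ^ k * (b - a) ∧
      (∀ x, a' * S.iterPropagate y k v x ≤ S.iterPropagate y k u x) ∧
      ∀ x, S.iterPropagate y k u x ≤ b' * S.iterPropagate y k v x := by
  induction k generalizing u v a b d with
  | zero => exact ⟨a, b, by simp, ha, hb⟩
  | succ k ih =>
    obtain ⟨a₁, b₁, h1, ha₁, hb₁⟩ := hS.propagate_ratio (y (k + 1)) hu hv hd hdv ha hb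
    obtain ⟨a', b', h2, h3⟩ := ih (hS.bdd_propagate (y (k + 1)) hu)
      (hS.bdd_propagate (y (k + 1)) hv) (mul_pos hS.pos hd)
      (hS.propagate_pos (y (k + 1)) hv hd hdv) ha₁ hb₁
    exact ⟨a', b', by rw [h2, h1]; ring, h3⟩

theorem StronglyMixing.bdd_iterPropagate [IsFiniteMeasure lX] (hS : S.StronglyMixing ε)
    (y : ℕ → Y) (k : ℕ) {f : X → ℝ} (hf : BddMeasurable f) :
    BddMeasurable (S.iterPropagate y k f) := by
  induction k generalizing f with
  | zero => exact hf
  | succ k ih => exact ih (hS.bdd_propagate _ hf)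

section Filter

variable [SigmaFinite lX] {m₀ : X → ℝ≥0}

theorem StronglyMixing.integral_unnormalizedFilter_succ [IsFiniteMeasure lX]
    (hS : S.StronglyMixing ε) (hm₀ : Measurable m₀)
    (hm₀_one : ∫⁻ x, (m₀ x : ℝ≥0∞) ∂lX = 1) (t : ℕ) (y : ℕ → Y) {f : X → ℝ}
    (hf : BddMeasurable f) :
    ∫ x, f x ∂(S.unnormalizedFilter m₀ (t + 1) y) =
      ∫ x, S.propagate (y (t + 1)) f x ∂(S.unnormalizedFilter m₀ t y) := by
  have := hS.isFiniteMeasure_unnormalizedFilter hm₀ hm₀_one (t + 1) y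
  have hint : Integrable f (S.unnormalizedFilter m₀ (t + 1) y) := hf.integrable
  rw [unnormalizedFilter_succ S hm₀, Measure.comp_eq_comp_const_apply] at hint ⊢
  rw [Kernel.integral_comp hint, Kernel.const_apply]
  refine integral_congr_ae (Eventually.of_forall fun x => ?_)
  dsimp only
  rw [updateKernel_apply, integral_withDensity_eq_integral_smul
    (S.measurable_updateDensity (y (t + 1))).of_uncurry_left]
  rfl

/-- By duality the newest observation acts on `f` first, so the induction removes updates from the
end. -/
theorem StronglyMixing.integral_unnormalizedFilter_add [IsFiniteMeasure lX]
    (hS : S.StronglyMixing ε) (hm₀ : Measurable m₀)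
    (hm₀_one : ∫⁻ x, (m₀ x : ℝ≥0∞) ∂lX = 1) (j k : ℕ) (y : ℕ → Y) {f : X → ℝ}
    (hf : BddMeasurable f) :
    ∫ x, f x ∂(S.unnormalizedFilter m₀ (j + k) y) =
      ∫ x, S.iterPropagate (fun i => y (j + i)) k f x ∂(S.unnormalizedFilter m₀ j y) := by
  induction k generalizing f with
  | zero => rfl
  | succ k ih =>
    rw [← add_assoc, hS.integral_unnormalizedFilter_succ hm₀ hm₀_one (j + k) y hf,
      ih (hS.bdd_propagate _ hf)]
    rfl

/-- Exponential forgetting of the filter. -/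
theorem StronglyMixing.filter_forgetting [Nonempty X] [IsFiniteMeasure lX]
    (hS : S.StronglyMixing ε) (hm₀ : Measurable m₀)
    (hm₀_one : ∫⁻ x, (m₀ x : ℝ≥0∞) ∂lX = 1) (j k : ℕ) {y y' : ℕ → Y}
    (hy : ∀ i < k, y (j + (i + 1)) = y' (i + 1)) {f : X → ℝ} {a b : ℝ} (hf : Measurable f)
    (hab : ∀ x, f x ∈ Set.Icc a b) :
    |∫ x, f x ∂(S.filter m₀ (j + k) y) - ∫ x, f x ∂(S.filter m₀ k y')| ≤
      (1 - ε ^ 2) ^ k * (b - a) := by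
  have hfb : BddMeasurable f := .of_mem_Icc hf hab
  -- With `v = 1`, the ratio of the two propagated functions is the conditional expectation of `f`
  -- given the state `k` steps earlier. It lies in an interval of length `(1 - ε ^ 2) ^ k * (b -
  -- a)`, whatever the law of that state.
  obtain ⟨a', b', h, ha, hb⟩ := hS.iterPropagate_ratio y' k hfb (BddMeasurable.const 1) one_pos
    (fun _ => le_rfl) (fun x => (mul_one a).le.trans (hab x).1)
    (fun x => (hab x).2.trans (mul_one b).ge)
  -- The starting time `n` is free: `n = j` gives the long filter and `n = 0` the restarted one.
  have key : ∀ (n : ℕ) (z : ℕ → Y), (∀ i < k, z (n + (i + 1)) = y' (i + 1)) →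
      ∫ x, f x ∂(S.filter m₀ (n + k) z) ∈ Set.Icc a' b' := by
    intro n z hz
    have := hS.isFiniteMeasure_unnormalizedFilter hm₀ hm₀_one n z
    have hpos : 0 < ∫ _x, (1 : ℝ) ∂(S.unnormalizedFilter m₀ (n + k) z) := by
      have h1 := hS.mass_ne hm₀ hm₀_one (n + k) z
      simpa [Measure.real] using ENNReal.toReal_pos h1.1 h1.2
    have hi1 := (hS.bdd_iterPropagate y' k (BddMeasurable.const 1)).integrable
      (μ := S.unnormalizedFilter m₀ n z)
    have hi2 := (hS.bdd_iterPropagate y' k hfb).integrable (μ := S.unnormalizedFilter m₀ n z)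
    rw [integral_filter, Set.mem_Icc, le_div_iff₀ hpos, div_le_iff₀ hpos,
      hS.integral_unnormalizedFilter_add hm₀ hm₀_one n k z (BddMeasurable.const 1),
      hS.integral_unnormalizedFilter_add hm₀ hm₀_one n k z hfb,
      iterPropagate_congr S (y := fun i => z (n + i)) (y' := y') k hz,
      iterPropagate_congr S (y := fun i => z (n + i)) (y' := y') k hz,
      ← integral_const_mul, ← integral_const_mul]
    exact ⟨integral_mono (hi1.const_mul _) hi2 ha, integral_mono hi2 (hi1.const_mul _) hb⟩
  have h1 := key j y hy
  have h2 := key 0 y' fun i _ => by rw [zero_add]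
  rw [zero_add] at h2
  rw [← h, abs_le]
  constructor <;> linarith [h1.1, h1.2, h2.1, h2.2]

end Filter

end StateSpaceModel

/-! ### Law of large numbers for functions of the recent history of a contracting Markov chain. -/

section MarkovChain

variable {Z : Type*} [MeasurableSpace Z]

/-- Prepend a new state to a history. -/
def histCons (z : Z) (b : ℕ → Z) : ℕ → Z
  | 0 => z
  | n + 1 => b n

theorem measurable_histCons : Measurable fun p : (ℕ → Z) × Z => histCons p.2 p.1 := by
  refine measurable_pi_lambda _ fun n => ?_
  cases n with
  | zero => exact measurable_snd
  | succ n => exact (measurable_pi_apply n).comp measurable_fst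

/-- The Markov operator of the chain of histories: `(histOp K φ) b` is the mean of `φ` at the
history following `b`, where `b 0` is the current state. -/
noncomputable def histOp (K : Kernel Z Z) (φ : (ℕ → Z) → ℝ) (b : ℕ → Z) : ℝ :=
  ∫ z, φ (histCons z b) ∂(K (b 0))

/-- The function `φ` depends only on the `n` most recent states. -/
def DependsOnFirst (n : ℕ) (φ : (ℕ → Z) → ℝ) : Prop :=
  ∀ b b' : ℕ → Z, (∀ i < n, b i = b' i) → φ b = φ b'

variable {K : Kernel Z Z} [IsMarkovKernel K] {φ : (ℕ → Z) → ℝ}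

theorem measurable_histOp (hφ : Measurable φ) : Measurable (histOp K φ) := by
  have h : StronglyMeasurable fun p : (ℕ → Z) × Z => φ (histCons p.2 p.1) :=
    (hφ.comp measurable_histCons).stronglyMeasurable
  exact (h.integral_kernel_prod_right'
    (κ := K.comap (fun b : ℕ → Z => b 0) (measurable_pi_apply 0))).measurable

theorem histOp_mem_Icc (hφ : Measurable φ) {a b : ℝ} (h : ∀ x, φ x ∈ Set.Icc a b) (x : ℕ → Z) :
    histOp K φ x ∈ Set.Icc a b :=
  integral_mem_Icc (hφ.comp (measurable_histCons.comp measurable_prodMk_left)) fun _ => h _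

theorem measurable_iterate_histOp (hφ : Measurable φ) (j : ℕ) :
    Measurable ((histOp K)^[j] φ) := by
  induction j generalizing φ with
  | zero => exact hφ
  | succ j ih => exact ih (measurable_histOp hφ)

theorem iterate_histOp_mem_Icc (hφ : Measurable φ) {a b : ℝ} (h : ∀ x, φ x ∈ Set.Icc a b) (j : ℕ)
    (x : ℕ → Z) : (histOp K)^[j] φ x ∈ Set.Icc a b := by
  induction j generalizing φ with
  | zero => exact h x
  | succ j ih => exact ih (measurable_histOp hφ) (histOp_mem_Icc hφ h)

omit [IsMarkovKernel K] in
-- The newest state is integrated out and the others move up by one. The current state is always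
-- needed by `K`, so the dependence never drops below one state.
theorem DependsOnFirst.histOp {n : ℕ} (h : DependsOnFirst (n + 2) φ) :
    DependsOnFirst (n + 1) (histOp K φ) := by
  intro b b' hb
  have : ∀ z, φ (histCons z b) = φ (histCons z b') := fun z => by
    refine h _ _ fun i hi => ?_
    cases i with
    | zero => rfl
    | succ i => exact hb i (by omega)
  simp only [_root_.histOp, this, hb 0 (Nat.succ_pos n)]

omit [IsMarkovKernel K] in
theorem DependsOnFirst.iterate_histOp {n : ℕ} (h : DependsOnFirst (n + 1) φ) :
    DependsOnFirst 1 ((_root_.histOp K)^[n] φ) := by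
  induction n generalizing φ with
  | zero => exact h
  | succ n ih => exact ih h.histOp

/-- A Markov kernel which contracts oscillations by the factor `c`. -/
def IsContracting (K : Kernel Z Z) (c : ℝ) : Prop :=
  ∀ (f : Z → ℝ) (a b : ℝ), Measurable f → (∀ x, f x ∈ Set.Icc a b) →
    ∀ z z', |∫ x, f x ∂(K z) - ∫ x, f x ∂(K z')| ≤ c * (b - a)

omit [IsMarkovKernel K] in
-- Once `φ` is a function of the current state alone, `histOp K` acts as `K` itself and contraction
-- applies, on an interval of length `d` starting at the infimum of `φ`.
theorem abs_histOp_sub_le [Nonempty Z] {c : ℝ} (hK : IsContracting K c) (hφ : BddMeasurable φ)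
    (hdep : DependsOnFirst 1 φ) {d : ℝ} (hd : ∀ b b', |φ b - φ b'| ≤ d) (b b' : ℕ → Z) :
    |histOp K φ b - histOp K φ b'| ≤ c * d := by
  have h1 : ∀ b, histOp K φ b = ∫ z, φ (fun _ => z) ∂(K (b 0)) := fun b => by
    refine integral_congr_ae (Eventually.of_forall fun z => hdep _ _ fun i hi => ?_)
    obtain rfl : i = 0 := by omega
    rfl
  obtain ⟨C, hC⟩ := hφ.2
  have hbdd : BddBelow (Set.range φ) := ⟨-C, by rintro _ ⟨x, rfl⟩; exact (abs_le.1 (hC x)).1⟩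
  have h2 : ∀ x, φ x ∈ Set.Icc (⨅ y, φ y) ((⨅ y, φ y) + d) := fun x => by
    refine ⟨ciInf_le hbdd x, ?_⟩
    have : φ x - d ≤ ⨅ y, φ y := le_ciInf fun y => by linarith [(abs_le.1 (hd x y)).2]
    linarith
  rw [h1, h1]
  have hconst : Measurable fun z : Z => (fun _ : ℕ => z) :=
    measurable_pi_lambda _ fun _ => measurable_id
  have := hK (fun z => φ fun _ => z) _ _ (hφ.1.comp hconst) (fun z => h2 _) (b 0) (b' 0)
  rwa [add_sub_cancel_left] at this

/-- For a contracting kernel, the iterates of a bounded function of finitely many states converge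
uniformly to a constant, with summable errors. -/
theorem exists_limit_iterate_histOp [Nonempty Z] {c : ℝ} (hc0 : 0 ≤ c) (hc1 : c < 1)
    (hK : IsContracting K c) {C : ℝ} (hφ : Measurable φ) (hC : ∀ b, |φ b| ≤ C) {n : ℕ}
    (hdep : DependsOnFirst (n + 1) φ) :
    ∃ (l : ℝ) (r : ℕ → ℝ), Summable r ∧ |l| ≤ C ∧ ∀ j b, |(histOp K)^[j] φ b - l| ≤ r j := by
  have hC0 : 0 ≤ C := by
    obtain ⟨z⟩ := ‹Nonempty Z›
    exact (abs_nonneg _).trans (hC fun _ => z)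
  have hCi : ∀ j b, |(histOp K)^[j] φ b| ≤ C := fun j b =>
    abs_le.2 (iterate_histOp_mem_Icc hφ (fun x => abs_le.1 (hC x)) j b)
  -- The first `n` steps only shed the dependence on older states; contraction starts at step `n`.
  set r : ℕ → ℝ := fun j => if j < n then 2 * C else c ^ (j - n) * (2 * C)
  have hr : Summable r := by
    rw [← summable_nat_add_iff n]
    refine ((summable_geometric_of_lt_one hc0 hc1).mul_right (2 * C)).congr fun j => ?_
    simp [r]
  have htriv : ∀ j b b', |(histOp K)^[j] φ b - (histOp K)^[j] φ b'| ≤ 2 * C := fun j b b' => by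
    have h1 := abs_le.1 (hCi j b)
    have h2 := abs_le.1 (hCi j b')
    rw [abs_le]; constructor <;> linarith [h1.1, h1.2, h2.1, h2.2]
  have hdep' : ∀ j, DependsOnFirst 1 ((histOp K)^[n + j] φ) := fun j => by
    induction j with
    | zero => exact hdep.iterate_histOp
    | succ j ih =>
      rw [← add_assoc, Function.iterate_succ_apply']
      exact DependsOnFirst.histOp fun b b' hb => ih b b' fun i hi => hb i (by omega)
  have hosc : ∀ j b b', |(histOp K)^[j] φ b - (histOp K)^[j] φ b'| ≤ r j := by
    have hgeo : ∀ j b b', |(histOp K)^[n + j] φ b - (histOp K)^[n + j] φ b'| ≤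
        c ^ j * (2 * C) := by
      intro j
      induction j with
      | zero => simpa using htriv n
      | succ j ih =>
        intro b b'
        rw [← add_assoc, Function.iterate_succ_apply', pow_succ', mul_assoc]
        exact abs_histOp_sub_le hK ⟨measurable_iterate_histOp hφ _, C, hCi _⟩ (hdep' j) ih b b'
    intro j b b'
    by_cases hj : j < n
    · simpa [r, hj] using htriv j b b'
    · have := hgeo (j - n) b b'
      rw [Nat.add_sub_cancel' (not_lt.1 hj)] at this
      simpa [r, hj] using this
  -- A later iterate is an average of values of the `j`-th one, so it stays within the oscillation
  -- of the latter.
  have hstep : ∀ j i b b', |(histOp K)^[j] φ b - (histOp K)^[i + j] φ b'| ≤ r j := by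
    intro j i b b'
    have h1 : ∀ x, (histOp K)^[j] φ x ∈
        Set.Icc ((histOp K)^[j] φ b - r j) ((histOp K)^[j] φ b + r j) := fun x => by
      have := abs_le.1 (hosc j b x)
      constructor <;> linarith [this.1, this.2]
    have h2 := iterate_histOp_mem_Icc (K := K) (measurable_iterate_histOp hφ j) h1 i b'
    rw [← Function.iterate_add_apply] at h2
    rw [abs_le]; constructor <;> linarith [h2.1, h2.2]
  obtain ⟨z⟩ := ‹Nonempty Z›
  have hcauchy : CauchySeq fun j => (histOp K)^[j] φ fun _ => z := by
    refine cauchySeq_of_le_tendsto_0' r (fun j m hjm => ?_) hr.tendsto_atTop_zero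
    have := hstep j (m - j) (fun _ => z) (fun _ => z)
    rwa [Nat.sub_add_cancel hjm] at this
  obtain ⟨l, hl⟩ := cauchySeq_tendsto_of_complete hcauchy
  refine ⟨l, r, hr, le_of_tendsto hl.abs (Eventually.of_forall fun j => hCi j _), fun j b => ?_⟩
  refine le_of_tendsto (hl.const_sub ((histOp K)^[j] φ b)).abs ?_
  filter_upwards [eventually_ge_atTop j] with m hm
  have := hstep j (m - j) b (fun _ => z)
  rwa [Nat.sub_add_cancel hm] at this

variable {Ω : Type*} [MeasurableSpace Ω] {P : Measure Ω} [IsProbabilityMeasure P]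
  {Zs : ℕ → Ω → Z}

/-- The history `Z_t, Z_{t-1}, …, Z_0`, continued by `Z_0`. -/
def chainHist (Zs : ℕ → Ω → Z) (t : ℕ) (ω : Ω) : ℕ → Z := fun i => Zs (t - i) ω

theorem measurable_chainHist (hZ : ∀ t, Measurable (Zs t)) (t : ℕ) :
    Measurable (chainHist Zs t) :=
  measurable_pi_lambda _ fun i => hZ (t - i)

omit [MeasurableSpace Ω] [MeasurableSpace Z] in
theorem chainHist_succ (t : ℕ) (ω : Ω) :
    chainHist Zs (t + 1) ω = histCons (Zs (t + 1) ω) (chainHist Zs t ω) := by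
  funext i
  cases i with
  | zero => rfl
  | succ i => simp [chainHist, histCons]

/-- The Markov property with transition kernel `K`, as a disintegration of the law of the first
`t + 2` states. -/
def HasMarkovProperty (P : Measure Ω) (Zs : ℕ → Ω → Z) (K : Kernel Z Z) : Prop :=
  ∀ t : ℕ, P.map (fun ω => (fun s : Fin (t + 1) => Zs s ω, Zs (t + 1) ω)) =
    (P.map (fun ω => fun s : Fin (t + 1) => Zs s ω)) ⊗ₘ
      K.comap (fun z => z (Fin.last t)) (measurable_pi_apply (Fin.last t))

theorem HasMarkovProperty.integral_mul_succ (hM : HasMarkovProperty P Zs K)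
    (hZ : ∀ t, Measurable (Zs t)) (t : ℕ) {G : (ℕ → Z) → ℝ} (hG : BddMeasurable G)
    (hφ : BddMeasurable φ) :
    ∫ ω, G (chainHist Zs t ω) * φ (chainHist Zs (t + 1) ω) ∂P =
      ∫ ω, G (chainHist Zs t ω) * histOp K φ (chainHist Zs t ω) ∂P := by
  -- Truncated subtraction repeats the initial state for `i > t`, exactly as in `chainHist`.
  let H : (Fin (t + 1) → Z) → ℕ → Z := fun v i => v ⟨t - i, by omega⟩
  have hH : Measurable H := measurable_pi_lambda _ fun i => measurable_pi_apply _
  have hpast : Measurable fun ω => fun s : Fin (t + 1) => Zs s ω :=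
    measurable_pi_lambda _ fun s => hZ s
  have : IsProbabilityMeasure (P.map fun ω => fun s : Fin (t + 1) => Zs s ω) :=
    Measure.isProbabilityMeasure_map hpast.aemeasurable
  have hF : BddMeasurable fun p : (Fin (t + 1) → Z) × Z =>
      G (H p.1) * φ (histCons p.2 (H p.1)) :=
    (hG.comp (hH.comp measurable_fst)).mul
      (hφ.comp (measurable_histCons.comp ((hH.comp measurable_fst).prodMk measurable_snd)))
  calc ∫ ω, G (chainHist Zs t ω) * φ (chainHist Zs (t + 1) ω) ∂P
      = ∫ p : (Fin (t + 1) → Z) × Z, G (H p.1) * φ (histCons p.2 (H p.1))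
          ∂(P.map (fun ω => (fun s : Fin (t + 1) => Zs s ω, Zs (t + 1) ω))) := by
        rw [integral_map (hpast.prodMk (hZ (t + 1))).aemeasurable hF.1.aestronglyMeasurable]
        simp only [chainHist_succ]
        rfl
    _ = ∫ v, ∫ z, G (H v) * φ (histCons z (H v)) ∂(K (v (Fin.last t)))
          ∂(P.map (fun ω => fun s : Fin (t + 1) => Zs s ω)) := by
        rw [hM t, Measure.integral_compProd hF.integrable]
        rfl
    _ = ∫ v, G (H v) * histOp K φ (H v)
          ∂(P.map (fun ω => fun s : Fin (t + 1) => Zs s ω)) := by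
        simp only [integral_const_mul]
        rfl
    _ = _ := by
        rw [integral_map hpast.aemeasurable]
        · rfl
        · exact ((hG.1.comp hH).mul ((measurable_histOp hφ.1).comp hH)).aestronglyMeasurable

theorem BddMeasurable.histOp (hφ : BddMeasurable φ) : BddMeasurable (histOp K φ) := by
  obtain ⟨C, hC⟩ := hφ.2
  exact .of_mem_Icc (measurable_histOp hφ.1) (histOp_mem_Icc hφ.1 fun x => abs_le.1 (hC x))

theorem HasMarkovProperty.integral_mul_add (hM : HasMarkovProperty P Zs K)
    (hZ : ∀ t, Measurable (Zs t)) (s j : ℕ) {G : (ℕ → Z) → ℝ} (hG : BddMeasurable G)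
    (hφ : BddMeasurable φ) :
    ∫ ω, G (chainHist Zs s ω) * φ (chainHist Zs (s + j) ω) ∂P =
      ∫ ω, G (chainHist Zs s ω) * (_root_.histOp K)^[j] φ (chainHist Zs s ω) ∂P := by
  induction j generalizing φ with
  | zero => rfl
  | succ j ih =>
    -- The history at time `s` is a tail of the one at `s + j`, so a function of it is an admissible
    -- multiplier for the one-step identity at time `s + j`.
    have hshift : ∀ ω, chainHist Zs s ω = fun i => chainHist Zs (s + j) ω (i + j) := fun ω => by
      funext i
      simp [chainHist, Nat.add_sub_add_right]
    have hG' : BddMeasurable fun b : ℕ → Z => G fun i => b (i + j) :=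
      hG.comp (measurable_pi_lambda _ fun i => measurable_pi_apply _)
    have h1 := hM.integral_mul_succ hZ (s + j) hG' hφ
    simp only [← hshift] at h1
    rw [← add_assoc, h1, ih hφ.histOp]
    rfl

/-- Law of large numbers for a bounded function of the recent history of a chain whose kernel
contracts oscillations. -/
theorem HasMarkovProperty.exists_tendsto_cesaro [Nonempty Z] (hM : HasMarkovProperty P Zs K)
    (hZ : ∀ t, Measurable (Zs t)) {c : ℝ} (hc0 : 0 ≤ c) (hc1 : c < 1)
    (hK : IsContracting K c) (hφ : BddMeasurable φ) {n : ℕ}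
    (hdep : DependsOnFirst (n + 1) φ) :
    ∃ l : ℝ, ∀ᵐ ω ∂P, Tendsto (fun T : ℕ => (T : ℝ)⁻¹ * ∑ s ∈ Finset.range T,
      φ (chainHist Zs (s + 1) ω)) atTop (𝓝 l) := by
  obtain ⟨hφm, C, hC⟩ := id hφ
  obtain ⟨l, r, hr, hlC, hlim⟩ := exists_limit_iterate_histOp hc0 hc1 hK hφm hC hdep
  refine ⟨l, ?_⟩
  have hG : BddMeasurable fun b => φ b - l := hφ.sub (.const l)
  have hGC : ∀ b, |φ b - l| ≤ 2 * C := fun b =>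
    (abs_sub _ _).trans (by linarith [hC b])
  have hm := fun t => measurable_chainHist (Zs := Zs) hZ t
  have hcorr : ∀ s j, |∫ ω, (φ (chainHist Zs (s + 1) ω) - l) *
      (φ (chainHist Zs (s + j + 1) ω) - l) ∂P| ≤ 2 * C * r j := by
    intro s j
    have hφj : BddMeasurable ((histOp K)^[j] φ) :=
      ⟨measurable_iterate_histOp hφm j, C, fun b =>
        abs_le.2 (iterate_histOp_mem_Icc hφm (fun x => abs_le.1 (hC x)) j b)⟩
    have h1 := hM.integral_mul_add hZ (s + 1) j hG hφ
    -- Conditioning on the history at time `s + 1` replaces the later value by the `j`-th iterate,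
    -- uniformly within `r j` of `l`; no stationarity is needed.
    have e : ∫ ω, (φ (chainHist Zs (s + 1) ω) - l) * (φ (chainHist Zs (s + j + 1) ω) - l) ∂P
        = ∫ ω, (φ (chainHist Zs (s + 1) ω) - l) *
          ((histOp K)^[j] φ (chainHist Zs (s + 1) ω) - l) ∂P := by
      simp only [mul_sub _ _ l]
      rw [integral_sub, integral_sub, show s + j + 1 = s + 1 + j by ring, h1]
      · exact ((hG.mul hφj).comp (hm _)).integrable
      · exact ((hG.mul (.const l)).comp (hm _)).integrable
      · exact ((hG.comp (hm _)).mul (hφ.comp (hm _))).integrable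
      · exact ((hG.mul (.const l)).comp (hm _)).integrable
    rw [e]
    have hb : ∀ ω, ‖(φ (chainHist Zs (s + 1) ω) - l) *
          ((histOp K)^[j] φ (chainHist Zs (s + 1) ω) - l)‖ ≤ 2 * C * r j := fun ω => by
      rw [norm_mul]
      exact mul_le_mul (hGC _) (hlim j _) (abs_nonneg _) ((abs_nonneg _).trans (hGC fun _ =>
        Zs 0 ω))
    simpa using norm_integral_le_of_norm_le_const (μ := P) (Eventually.of_forall hb)
  have hlln := ae_tendsto_cesaro_of_summable_correlation
    (ξ := fun s ω => φ (chainHist Zs (s + 1) ω) - l)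
    (fun s => hG.1.comp (hm _)) (fun s ω => hGC _) (hr.mul_left (2 * C)) hcorr
  filter_upwards [hlln] with ω hω
  have := hω.add_const l
  rw [zero_add] at this
  refine this.congr' ?_
  filter_upwards [eventually_ne_atTop 0] with T hT
  rw [Finset.sum_sub_distrib]
  simp only [Finset.sum_const, Finset.card_range, nsmul_eq_mul]
  field_simp
  ring

end MarkovChain

theorem abs_log_sub_log_le {ε x y : ℝ} (hε : 0 < ε) (hx : ε ≤ x) (hy : ε ≤ y) :
    |Real.log x - Real.log y| ≤ |x - y| / ε := by
  have key : ∀ {x y : ℝ}, ε ≤ x → ε ≤ y → Real.log x - Real.log y ≤ |x - y| / ε := by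
    intro x y hx hy
    have hx0 := hε.trans_le hx
    have hy0 := hε.trans_le hy
    rw [← Real.log_div hx0.ne' hy0.ne']
    calc Real.log (x / y) ≤ x / y - 1 := Real.log_le_sub_one_of_pos (div_pos hx0 hy0)
      _ = (x - y) / y := by field_simp
      _ ≤ |x - y| / ε := div_le_div₀ (abs_nonneg _) (le_abs_self _) hε hy
  rw [abs_le]
  have h1 := key hx hy
  have h2 := key hy hx
  rw [abs_sub_comm] at h2
  constructor <;> linarith

/-! ### Ergodicity of the data chain, and existence of the two limits. -/

namespace StateSpaceModel

variable {X Y U : Type*} [MeasurableSpace X] [MeasurableSpace Y] [MeasurableSpace U]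
  {lX : Measure X} {lY : Measure Y} {ν : Measure U}

/-- Doeblin minorisation. Since emissions depend only on the new state, only `D.m` matters:
subtracting the common part `ε * lX` leaves mass `1 - ε * Λ`, and `m ≤ ε⁻¹` with total mass `1`
forces `Λ ≥ ε`. -/
theorem isContracting_jointKernel [SigmaFinite lX] [SigmaFinite lY] [IsFiniteMeasure lX]
    (D : StateSpaceModel lX lY) {ε : ℝ} (hε : 0 < ε)
    (hD : ∀ x x', ε ≤ (D.m x x' : ℝ) ∧ (D.m x x' : ℝ) ≤ ε⁻¹) :
    IsContracting D.jointKernel (1 - ε ^ 2) := by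
  intro f a b hf hab z z'
  set h : X → ℝ := fun x' => ∫ y', f (x', y') ∂(D.emissionKernel x')
  have hh : Measurable h := (hf.stronglyMeasurable.integral_kernel_prod_right').measurable
  have hhab : ∀ x, h x ∈ Set.Icc a b := fun x =>
    integral_mem_Icc (hf.comp measurable_prodMk_left) fun y => hab _
  have hm : ∀ x, BddMeasurable fun x' => (D.m x x' : ℝ) := fun x =>
    .of_mem_Icc D.measurable_m.of_uncurry_left.coe_nnreal_real fun x' => hD x x'
  have hhb : BddMeasurable h := .of_mem_Icc hh hhab
  have hrep : ∀ z : X × Y, ∫ p, f p ∂(D.jointKernel z) = ∫ x', (D.m z.1 x' : ℝ) * h x' ∂lX := by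
    intro z
    rw [jointKernel, Kernel.prodMkRight_apply, ProbabilityTheory.integral_compProd
      (integrable_of_mem_Icc hf hab), stateKernel, Kernel.withDensity_apply _
      D.measurable_m.coe_nnreal_ennreal, Kernel.const_apply,
      integral_withDensity_eq_integral_smul D.measurable_m.of_uncurry_left]
    rfl
  set Λ := lX.real Set.univ
  have hΛ : ε ≤ Λ := by
    have h1 : ∫ x', (D.m z.1 x' : ℝ) ∂lX ≤ ∫ _x', ε⁻¹ ∂lX :=
      integral_mono (hm _).integrable (integrable_const _) fun x' => (hD _ x').2
    rw [D.integral_m, integral_const, smul_eq_mul, ← div_eq_mul_inv, one_le_div hε] at h1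
    exact h1
  have hres : ∀ x, ∫ x', ((D.m x x' : ℝ) - ε) * h x' ∂lX ∈
      Set.Icc ((1 - ε * Λ) * a) ((1 - ε * Λ) * b) := fun x => by
    have h1 : ∀ c : ℝ, ∫ x', ((D.m x x' : ℝ) - ε) * c ∂lX = (1 - ε * Λ) * c := fun c => by
      rw [integral_mul_const, integral_sub (hm x).integrable (integrable_const _), D.integral_m,
        integral_const, smul_eq_mul, mul_comm ε]
    rw [← h1 a, ← h1 b]
    have hi := ((hm x).sub (.const ε)).integrable (μ := lX)
    have hi' := (((hm x).sub (.const ε)).mul hhb).integrable (μ := lX)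
    exact ⟨integral_mono (hi.mul_const a) hi' fun x' =>
        mul_le_mul_of_nonneg_left (hhab x').1 (sub_nonneg.2 (hD x x').1),
      integral_mono hi' (hi.mul_const b) fun x' =>
        mul_le_mul_of_nonneg_left (hhab x').2 (sub_nonneg.2 (hD x x').1)⟩
  have hsplit : ∀ x, ∫ x', (D.m x x' : ℝ) * h x' ∂lX =
      ∫ x', ((D.m x x' : ℝ) - ε) * h x' ∂lX + ε * ∫ x', h x' ∂lX := fun x => by
    rw [← integral_const_mul, ← integral_add]
    · congr 1; funext x'; ring
    · exact (((hm x).sub (.const ε)).mul hhb).integrable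
    · exact hhb.integrable.const_mul _
  rw [hrep, hrep, hsplit, hsplit, add_sub_add_right_eq_sub]
  have hba : 0 ≤ b - a := sub_nonneg.2 ((hab z).1.trans (hab z).2)
  have h3 : (1 - ε * Λ) * (b - a) ≤ (1 - ε ^ 2) * (b - a) :=
    mul_le_mul_of_nonneg_right (by nlinarith) hba
  have h1 := hres z.1
  have h2 := hres z'.1
  rw [abs_le]
  constructor <;> linarith [h1.1, h1.2, h2.1, h2.2]

section Functional

variable {Ω : Type*} [MeasurableSpace Ω] {P : Measure Ω} [IsProbabilityMeasure P]
  [SigmaFinite lX] [SigmaFinite lY]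

/-- Every pair of integrals of a function with values in `[a, b]` differs by at most
`δ * (b - a)`. -/
def TVClose (δ : ℝ) (μ μ' : Measure X) : Prop :=
  ∀ (f : X → ℝ) (a b : ℝ), Measurable f → (∀ x, f x ∈ Set.Icc a b) →
    |∫ x, f x ∂μ - ∫ x, f x ∂μ'| ≤ δ * (b - a)

/-- The Cesàro means of a bounded, measurable, Lipschitz functional of the new observation and the
filter converge almost surely to a constant. -/
theorem exists_tendsto_cesaro_filter [Nonempty X] {S D : StateSpaceModel lX lY} {ε : ℝ}
    (hS : S.StronglyMixing ε) {m₀ : X → ℝ≥0} (hm₀ : Measurable m₀)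
    (hm₀_one : ∫⁻ x, (m₀ x : ℝ≥0∞) ∂lX = 1)
    (hD : ∀ x x', ε ≤ (D.m x x' : ℝ) ∧ (D.m x x' : ℝ) ≤ ε⁻¹)
    {Xs : ℕ → Ω → X} {Ys : ℕ → Ω → Y} (hdata : IsOutputOf P Xs Ys D m₀)
    (F : Y → Measure X → ℝ) {C L : ℝ}
    (hC : ∀ y (μ : Measure X) [IsProbabilityMeasure μ], |F y μ| ≤ C)
    (hL : ∀ y (μ μ' : Measure X) [IsProbabilityMeasure μ] [IsProbabilityMeasure μ'] (δ : ℝ),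
      TVClose δ μ μ' → |F y μ - F y μ'| ≤ L * δ)
    (hF : ∀ (κ : Kernel (ℕ → X × Y) X) [IsMarkovKernel κ],
      Measurable fun b : ℕ → X × Y => F (b 0).2 (κ b)) :
    ∃ l : ℝ, ∀ᵐ ω ∂P, Tendsto (fun T : ℕ => (T : ℝ)⁻¹ * ∑ s ∈ Finset.range T,
      F (Ys (s + 1) ω) (S.filter m₀ s (fun t => Ys t ω))) atTop (𝓝 l) := by
  have hε := hS.pos
  have hε1 := hS.lt_one
  have : IsFiniteMeasure lX := D.isFiniteMeasure_of_le hε fun x x' => (hD x x').1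
  have hprob := fun t y => hS.isProbabilityMeasure_filter hm₀ hm₀_one t y
  have : Nonempty Ω := P.nonempty_of_neZero
  have : Nonempty (X × Y) := by
    obtain ⟨ω⟩ := ‹Nonempty Ω›
    exact ⟨(Xs 0 ω, Ys 0 ω)⟩
  set Zs : ℕ → Ω → X × Y := fun t ω => (Xs t ω, Ys t ω)
  have hZ : ∀ t, Measurable (Zs t) := fun t =>
    (hdata.measurable_state t).prodMk (hdata.measurable_obs t)
  have hMarkov : HasMarkovProperty P Zs D.jointKernel := hdata.markov
  -- In the history at time `s + 1`, entry `0` carries the new observation and entry `k + 1 - i` has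
  -- time `s - k + i`. So `obs k` feeds a filter restarted at time `s - k` with the observations up
  -- to time `s`.
  set obs : ℕ → (ℕ → X × Y) → ℕ → Y := fun k b i => (b (k + 1 - i)).2
  have hobs : ∀ k, Measurable (obs k) := fun k =>
    measurable_pi_lambda _ fun i => measurable_snd.comp (measurable_pi_apply _)
  set φ : ℕ → (ℕ → X × Y) → ℝ := fun k b => F (b 0).2 (S.filter m₀ k (obs k b))
  have hφ : ∀ k, BddMeasurable (φ k) := fun k => by
    let κ : Kernel (ℕ → X × Y) X :=
      ⟨fun b => S.filter m₀ k (obs k b), (S.measurable_filter hm₀ k).comp (hobs k)⟩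
    have : IsMarkovKernel κ := ⟨fun b => hprob k _⟩
    exact ⟨hF κ, C, fun b => hC _ _⟩
  have hdep : ∀ k, DependsOnFirst (k + 1 + 1) (φ k) := fun k b b' hb => by
    have h1 : obs k b = obs k b' := funext fun i => by
      simp only [obs, hb (k + 1 - i) (by omega)]
    simp only [φ, h1, hb 0 (by omega)]
  have hc0 : 0 ≤ 1 - ε ^ 2 := by nlinarith
  have hc1 : 1 - ε ^ 2 < 1 := by nlinarith
  choose c hc using fun k => hMarkov.exists_tendsto_cesaro hZ hc0 hc1
    (D.isContracting_jointKernel hε hD) (hφ k) (hdep k)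
  have hδ : Tendsto (fun k => L * (1 - ε ^ 2) ^ k) atTop (𝓝 0) := by
    simpa using (tendsto_pow_atTop_nhds_zero_of_lt_one hc0 hc1).const_mul L
  have happrox : ∀ ω k s, k ≤ s → |F (Ys (s + 1) ω) (S.filter m₀ s (fun t => Ys t ω)) -
      φ k (chainHist Zs (s + 1) ω)| ≤ L * (1 - ε ^ 2) ^ k := by
    intro ω k s hks
    obtain ⟨j, rfl⟩ := Nat.exists_eq_add_of_le' hks
    refine hL _ _ _ _ fun f a b hf hab => ?_
    refine hS.filter_forgetting hm₀ hm₀_one j k (fun i hi => ?_) hf hab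
    simp only [obs, chainHist, Zs]
    congr 1
    omega
  have hall := ae_all_iff.2 hc
  -- The constants `c k` are deterministic, so one good path suffices to show that they are Cauchy.
  obtain ⟨ω, hω⟩ := hall.exists
  obtain ⟨l, hl⟩ := cauchySeq_tendsto_of_complete (tendsto_cesaro_of_approx hδ (happrox ω) hω).1
  refine ⟨l, ?_⟩
  filter_upwards [hall] with ω hω
  exact (tendsto_cesaro_of_approx hδ (happrox ω) hω).2 l hl

variable {S : StateSpaceModel lX lY} {ε : ℝ}

/-- The predictive likelihood given the current state. -/
noncomputable def predLik (S : StateSpaceModel lX lY) (y : Y) (x : X) : ℝ :=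
  ∫ x', (S.g x' y : ℝ) * (S.m x x' : ℝ) ∂lX

omit [SigmaFinite lY] in
theorem measurable_predLik (S : StateSpaceModel lX lY) :
    Measurable fun p : Y × X => S.predLik p.1 p.2 := by
  have h : StronglyMeasurable fun p : (Y × X) × X => (S.g p.2 p.1.1 : ℝ) * (S.m p.1.2 p.2 : ℝ) :=
    ((S.measurable_g.comp (measurable_snd.prodMk
      (measurable_fst.comp measurable_fst))).coe_nnreal_real.mul
      (S.measurable_m.comp ((measurable_snd.comp measurable_fst).prodMk
        measurable_snd)).coe_nnreal_real).stronglyMeasurable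
  exact h.integral_prod_right'.measurable

omit [SigmaFinite lX] [SigmaFinite lY] in
theorem StronglyMixing.predLik_mem_Icc [IsFiniteMeasure lX] (hS : S.StronglyMixing ε) (y : Y)
    (x : X) : S.predLik y x ∈ Set.Icc ε ε⁻¹ := by
  have hε := hS.pos
  have h1 : ∀ c : ℝ, ∫ x', c * (S.m x x' : ℝ) ∂lX = c := fun c => by
    rw [integral_const_mul, S.integral_m, mul_one]
  have hi := ((hS.bdd_g y).mul (hS.bdd_m x)).integrable (μ := lX)
  constructor
  · refine (h1 ε).symm.le.trans (integral_mono ((hS.bdd_m x).integrable.const_mul _) hi fun x' => ?_)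
    exact mul_le_mul_of_nonneg_right (hS.le_g x' y) (NNReal.coe_nonneg _)
  · refine (integral_mono hi ((hS.bdd_m x).integrable.const_mul _) fun x' => ?_).trans (h1 ε⁻¹).le
    exact mul_le_mul_of_nonneg_right (hS.g_le x' y) (NNReal.coe_nonneg _)

theorem StronglyMixing.exists_tendsto_logLik [Nonempty X] {D : StateSpaceModel lX lY}
    (hS : S.StronglyMixing ε) {m₀ : X → ℝ≥0} (hm₀ : Measurable m₀)
    (hm₀_one : ∫⁻ x, (m₀ x : ℝ≥0∞) ∂lX = 1)
    (hD : ∀ x x', ε ≤ (D.m x x' : ℝ) ∧ (D.m x x' : ℝ) ≤ ε⁻¹)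
    {Xs : ℕ → Ω → X} {Ys : ℕ → Ω → Y} (hdata : IsOutputOf P Xs Ys D m₀) :
    ∃ l : ℝ, ∀ᵐ ω ∂P, Tendsto (fun T : ℕ => (T : ℝ)⁻¹ * ∑ s ∈ Finset.range T,
      S.logLik (Ys (s + 1) ω) (S.filter m₀ s (fun t => Ys t ω))) atTop (𝓝 l) := by
  have hε := hS.pos
  have : IsFiniteMeasure lX := D.isFiniteMeasure_of_le hε fun x x' => (hD x x').1
  have hmeas : ∀ y, Measurable (S.predLik y) := fun y =>
    S.measurable_predLik.comp measurable_prodMk_left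
  have hmem : ∀ y (μ : Measure X) [IsProbabilityMeasure μ],
      ∫ x, S.predLik y x ∂μ ∈ Set.Icc ε ε⁻¹ := fun y μ _ =>
    integral_mem_Icc (hmeas y) (hS.predLik_mem_Icc y)
  -- `L` is the oscillation `ε⁻¹ - ε` of the predictive likelihood times the Lipschitz constant `1 /
  -- ε` of `log` on `[ε, ∞)`.
  refine exists_tendsto_cesaro_filter hS hm₀ hm₀_one hD hdata S.logLik
    (C := max |Real.log ε| |Real.log ε⁻¹|) (L := (ε⁻¹ - ε) / ε) (fun y μ _ => ?_)
    (fun y μ μ' _ _ δ h => ?_) fun κ _ => ?_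
  · have := log_mem_Icc hε (hmem y μ)
    exact abs_le_max_abs_abs this.1 this.2
  · refine (abs_log_sub_log_le hε (hmem y μ).1 (hmem y μ').1).trans ?_
    rw [div_mul_eq_mul_div, mul_comm _ δ]
    exact div_le_div_of_nonneg_right (h _ _ _ (hmeas y) (hS.predLik_mem_Icc y)) hε.le
  · have h : StronglyMeasurable fun p : (ℕ → X × Y) × X => S.predLik (p.1 0).2 p.2 :=
      (S.measurable_predLik.comp ((measurable_snd.comp
        ((measurable_pi_apply 0).comp measurable_fst)).prodMk measurable_snd)).stronglyMeasurable
    exact Real.measurable_log.comp (h.integral_kernel_prod_right' (κ := κ)).measurable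

/-! ### Importance weights and their bounds. -/

section Weight

variable {Q : Proposal Y lX ν}

omit [SigmaFinite lX] [SigmaFinite lY] in
theorem measurable_weight (S : StateSpaceModel lX lY) (Q : Proposal Y lX ν) :
    Measurable fun p : X × Y × U => S.weight Q p.1 p.2.1 p.2.2 := by
  have hy : Measurable fun p : X × Y × U => p.2.1 := measurable_fst.comp measurable_snd
  exact ((S.measurable_m.comp (measurable_fst.prodMk Q.measurable_h)).coe_nnreal_real.mul
    (S.measurable_g.comp (Q.measurable_h.prodMk hy)).coe_nnreal_real).div
    (Q.measurable_r.comp (measurable_fst.prodMk (hy.prodMk Q.measurable_h))).coe_nnreal_real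

omit [SigmaFinite lX] [SigmaFinite lY] in
theorem StronglyMixing.weight_mem_Icc (hS : S.StronglyMixing ε)
    (hr : ∀ x y x', ε ≤ (Q.r x y x' : ℝ) ∧ (Q.r x y x' : ℝ) ≤ ε⁻¹) (x : X) (y : Y) (u : U) :
    S.weight Q x y u ∈ Set.Icc (ε ^ 3) ((ε ^ 3)⁻¹) := by
  have hε := hS.pos
  set x' := Q.h x y u
  have hr0 : 0 < (Q.r x y x' : ℝ) := hε.trans_le (hr x y x').1
  have h1 := hS.le_m x x'
  have h2 := hS.m_le x x'
  have h3 := hS.le_g x' y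
  have h4 := hS.g_le x' y
  obtain ⟨h5, h6⟩ := hr x y x'
  constructor
  · calc ε ^ 3 = ε * ε / ε⁻¹ := by field_simp
      _ ≤ S.weight Q x y u := by unfold weight; gcongr
  · calc S.weight Q x y u ≤ ε⁻¹ * ε⁻¹ / ε := by unfold weight; gcongr
      _ = (ε ^ 3)⁻¹ := by field_simp

omit [SigmaFinite lX] [SigmaFinite lY] in
-- Importance-sampling identity: `h` pushes `ν` to the density `r`, which cancels the denominator.
theorem integral_weight (S : StateSpaceModel lX lY) (Q : Proposal Y lX ν)
    (hr : ∀ x y x', 0 < (Q.r x y x' : ℝ)) (x : X) (y : Y) :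
    ∫ u, S.weight Q x y u ∂ν = S.predLik y x := by
  have hh : Measurable (Q.h x y) :=
    Q.measurable_h.comp (measurable_const.prodMk (measurable_const.prodMk measurable_id))
  have hrm : Measurable fun x' => Q.r x y x' :=
    Q.measurable_r.comp (measurable_const.prodMk (measurable_const.prodMk measurable_id))
  have hq : Measurable fun x' => (S.m x x' : ℝ) * (S.g x' y : ℝ) / (Q.r x y x' : ℝ) :=
    (S.measurable_m.of_uncurry_left.coe_nnreal_real.mul
      (S.measurable_g.comp measurable_prodMk_right).coe_nnreal_real).div hrm.coe_nnreal_real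
  have h1 : ∫ u, S.weight Q x y u ∂ν =
      ∫ x', (S.m x x' : ℝ) * (S.g x' y : ℝ) / (Q.r x y x' : ℝ) ∂(ν.map (Q.h x y)) := by
    rw [integral_map hh.aemeasurable hq.aestronglyMeasurable]
    rfl
  rw [h1, Q.map_h, integral_withDensity_eq_integral_smul hrm]
  refine integral_congr_ae (Eventually.of_forall fun x' => ?_)
  simp only [NNReal.smul_def, smul_eq_mul]
  rw [mul_div_cancel₀ _ (hr x y x').ne', mul_comm]

omit [SigmaFinite lX] [SigmaFinite lY] in
theorem iwaeBound_eq (S : StateSpaceModel lX lY) (Q : Proposal Y lX ν) (M : ℕ) (y : Y)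
    (μ : Measure X) :
    S.iwaeBound Q M y μ = iwLogMean (μ.prod ν) (fun p => S.weight Q p.1 y p.2) M := rfl

omit [SigmaFinite lX] [SigmaFinite lY] in
theorem measurable_weight_prod (S : StateSpaceModel lX lY) (Q : Proposal Y lX ν) (y : Y) :
    Measurable fun p : X × U => S.weight Q p.1 y p.2 :=
  (S.measurable_weight Q).comp (measurable_fst.prodMk (measurable_const.prodMk measurable_snd))

variable [IsProbabilityMeasure ν]

omit [SigmaFinite lX] [SigmaFinite lY] in
theorem StronglyMixing.logLik_eq (hS : S.StronglyMixing ε)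
    (hr : ∀ x y x', ε ≤ (Q.r x y x' : ℝ) ∧ (Q.r x y x' : ℝ) ≤ ε⁻¹) (y : Y) (μ : Measure X)
    [IsProbabilityMeasure μ] :
    S.logLik y μ = Real.log (∫ p, S.weight Q p.1 y p.2 ∂(μ.prod ν)) := by
  rw [integral_prod _ (integrable_of_mem_Icc (S.measurable_weight_prod Q y)
    fun p => hS.weight_mem_Icc hr p.1 y p.2)]
  simp only [S.integral_weight Q fun x y x' => hS.pos.trans_le (hr x y x').1]
  rfl

omit [SigmaFinite lX] [SigmaFinite lY] in
theorem StronglyMixing.iwaeBound_le_logLik (hS : S.StronglyMixing ε)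
    (hr : ∀ x y x', ε ≤ (Q.r x y x' : ℝ) ∧ (Q.r x y x' : ℝ) ≤ ε⁻¹) {M : ℕ} (hM : 1 ≤ M) (y : Y)
    (μ : Measure X) [IsProbabilityMeasure μ] :
    S.iwaeBound Q M y μ ≤ S.logLik y μ := by
  rw [hS.logLik_eq hr]
  exact iwLogMean_le_log_integral (S.measurable_weight_prod Q y) (pow_pos hS.pos 3)
    (fun p => hS.weight_mem_Icc hr p.1 y p.2) hM

omit [SigmaFinite lX] [SigmaFinite lY] in
theorem StronglyMixing.iwaeBound_le_succ (hS : S.StronglyMixing ε)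
    (hr : ∀ x y x', ε ≤ (Q.r x y x' : ℝ) ∧ (Q.r x y x' : ℝ) ≤ ε⁻¹) {M : ℕ} (hM : 1 ≤ M) (y : Y)
    (μ : Measure X) [IsProbabilityMeasure μ] :
    S.iwaeBound Q M y μ ≤ S.iwaeBound Q (M + 1) y μ :=
  iwLogMean_le_succ (S.measurable_weight_prod Q y) (pow_pos hS.pos 3)
    (fun p => hS.weight_mem_Icc hr p.1 y p.2) hM

omit [SigmaFinite lX] [SigmaFinite lY] in
theorem StronglyMixing.logLik_le_iwaeBound_add (hS : S.StronglyMixing ε)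
    (hr : ∀ x y x', ε ≤ (Q.r x y x' : ℝ) ∧ (Q.r x y x' : ℝ) ≤ ε⁻¹) {M : ℕ} (hM : 1 ≤ M) (y : Y)
    (μ : Measure X) [IsProbabilityMeasure μ] :
    S.logLik y μ ≤ S.iwaeBound Q M y μ + (ε ^ 8)⁻¹ / (2 * M) := by
  have hε := hS.pos
  have h := log_integral_sub_iwLogMean_le (ρ := μ.prod ν) (S.measurable_weight_prod Q y)
    (pow_pos hS.pos 3) (fun p => hS.weight_mem_Icc hr p.1 y p.2) hM
  rw [← hS.logLik_eq hr] at h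
  -- The argument yields exponent `6`; it is weakened to `8` using `ε < 1`.
  have h1 : (ε ^ 3)⁻¹ / ε ^ 3 ≤ (ε ^ 8)⁻¹ := by
    rw [div_eq_mul_inv, ← mul_inv]
    refine inv_anti₀ (by positivity) ?_
    rw [← pow_add]
    exact pow_le_pow_of_le_one hε.le hS.lt_one.le (by norm_num)
  have h2 : (ε ^ 3)⁻¹ / ε ^ 3 / (2 * M) ≤ (ε ^ 8)⁻¹ / (2 * M) := by gcongr
  rw [iwaeBound_eq]
  linarith

theorem StronglyMixing.exists_tendsto_iwaeBound [Nonempty X] {D : StateSpaceModel lX lY}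
    (hS : S.StronglyMixing ε)
    (hr : ∀ x y x', ε ≤ (Q.r x y x' : ℝ) ∧ (Q.r x y x' : ℝ) ≤ ε⁻¹) {M : ℕ} (hM : 1 ≤ M)
    {m₀ : X → ℝ≥0} (hm₀ : Measurable m₀)
    (hm₀_one : ∫⁻ x, (m₀ x : ℝ≥0∞) ∂lX = 1)
    (hD : ∀ x x', ε ≤ (D.m x x' : ℝ) ∧ (D.m x x' : ℝ) ≤ ε⁻¹)
    {Xs : ℕ → Ω → X} {Ys : ℕ → Ω → Y} (hdata : IsOutputOf P Xs Ys D m₀) :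
    ∃ l : ℝ, ∀ᵐ ω ∂P, Tendsto (fun T : ℕ => (T : ℝ)⁻¹ * ∑ s ∈ Finset.range T,
      S.iwaeBound Q M (Ys (s + 1) ω) (S.filter m₀ s (fun t => Ys t ω))) atTop (𝓝 l) := by
  have hε := hS.pos
  have hw := fun (y : Y) (p : X × U) => hS.weight_mem_Icc hr p.1 y p.2
  have hlog := fun (y : Y) (z : Fin M → X × U) =>
    log_mem_Icc (pow_pos hε 3) (mean_mem_Icc (hw y) hM z)
  have hmeas := fun y : Y => measurable_log_mean (S.measurable_weight_prod Q y) M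
  -- The Lipschitz constant carries a factor `M`, one exchange per sample; this is harmless as `M`
  -- is fixed.
  refine exists_tendsto_cesaro_filter hS hm₀ hm₀_one hD hdata (S.iwaeBound Q M)
    (C := max |Real.log (ε ^ 3)| |Real.log (ε ^ 3)⁻¹|)
    (L := M * (Real.log (ε ^ 3)⁻¹ - Real.log (ε ^ 3))) (fun y μ _ => ?_)
    (fun y μ μ' _ _ δ h => ?_) fun κ _ => ?_
  · have := integral_mem_Icc (μ := Measure.pi fun _ : Fin M => μ.prod ν) (hmeas y) (hlog y)
    exact abs_le_max_abs_abs this.1 this.2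
  · have := abs_integral_pi_sub_le (μ := μ.prod ν) (μ' := μ'.prod ν)
      (fun f a b hf hab => abs_integral_prod_sub_le h hf hab) M (hmeas y) (hlog y)
    refine this.trans (le_of_eq ?_)
    ring
  · have hG : Measurable fun p : (ℕ → X × Y) × (Fin M → X × U) =>
        Real.log ((M : ℝ)⁻¹ * ∑ i, S.weight Q (p.2 i).1 (p.1 0).2 (p.2 i).2) := by
      refine Real.measurable_log.comp ((Finset.measurable_sum _ fun i _ => ?_).const_mul _)
      have h : Measurable fun p : (ℕ → X × Y) × (Fin M → X × U) =>
          ((p.2 i).1, (p.1 0).2, (p.2 i).2) := by fun_prop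
      exact (S.measurable_weight Q).comp h
    have := measurable_integral_pi_kernel (κ ×ₖ Kernel.const _ ν) M hG
    simp only [Kernel.prod_apply, Kernel.const_apply] at this
    exact this

end Weight

end Functional

end StateSpaceModel

/-! ### Passage to the limit and conclusion. -/

theorem le_add_of_tendsto_cesaro {a b : ℕ → ℝ} {c la lb : ℝ} (hc : 0 ≤ c)
    (h : ∀ s, a s ≤ b s + c)
    (ha : Tendsto (fun T : ℕ => (T : ℝ)⁻¹ * ∑ s ∈ Finset.range T, a s) atTop (𝓝 la))
    (hb : Tendsto (fun T : ℕ => (T : ℝ)⁻¹ * ∑ s ∈ Finset.range T, b s) atTop (𝓝 lb)) :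
    la ≤ lb + c := by
  refine le_of_tendsto_of_tendsto' ha (hb.add_const c) fun T => ?_
  rcases eq_or_ne T 0 with rfl | hT
  · simpa using hc
  have h1 : ∑ s ∈ Finset.range T, a s ≤ ∑ s ∈ Finset.range T, b s + T * c := by
    refine (Finset.sum_le_sum fun s _ => h s).trans (le_of_eq ?_)
    simp [Finset.sum_add_distrib]
  calc (T : ℝ)⁻¹ * ∑ s ∈ Finset.range T, a s
      ≤ (T : ℝ)⁻¹ * (∑ s ∈ Finset.range T, b s + T * c) := by gcongr
    _ = _ := by field_simp

theorem proposition3p2 {X Y U Θ Ω : Type*} [MeasurableSpace X] [MeasurableSpace Y]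
    [MeasurableSpace U] [MeasurableSpace Ω]
    (lX : Measure X) (lY : Measure Y) [SigmaFinite lX] [SigmaFinite lY]
    (ν : Measure U) [IsProbabilityMeasure ν] (P : Measure Ω) [IsProbabilityMeasure P]
    -- the parametric model, the proposal, and the initial density
    (S : Θ → StateSpaceModel lX lY) (Q : Θ → Proposal Y lX ν) (m₀ : X → ℝ≥0)
    (hm₀ : Measurable m₀) (hm₀_one : ∫⁻ x, (m₀ x : ℝ≥0∞) ∂lX = 1)
    -- the data-generating model, possibly outside the parametric family, and the data
    (D : StateSpaceModel lX lY) (Xs : ℕ → Ω → X) (Ys : ℕ → Ω → Y)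
    (hdata : IsOutputOf P Xs Ys D m₀)
    -- the strong mixing assumptions
    (ε : ℝ) (hε : 0 < ε ∧ ε < 1)
    (hm : ∀ θ x x', ε ≤ ((S θ).m x x' : ℝ) ∧ ((S θ).m x x' : ℝ) ≤ ε⁻¹)
    (hg : ∀ θ x y, ε ≤ ((S θ).g x y : ℝ) ∧ ((S θ).g x y : ℝ) ≤ ε⁻¹)
    (hr : ∀ θ x y x', ε ≤ ((Q θ).r x y x' : ℝ) ∧ ((Q θ).r x y x' : ℝ) ≤ ε⁻¹)
    (hD : ∀ x x', ε ≤ (D.m x x' : ℝ) ∧ (D.m x x' : ℝ) ≤ ε⁻¹) :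
    ∃ (ℓ : Θ → ℝ) (ℓM : ℕ → Θ → ℝ),
      IsContrast P Ys S m₀ ℓ ∧
      (∀ M : ℕ, 1 ≤ M → IsCOLBO P Ys S Q m₀ M (ℓM M)) ∧
      (∀ θ, ∀ M : ℕ, 1 ≤ M → ℓ θ ≥ ℓM (M + 1) θ ∧ ℓM (M + 1) θ ≥ ℓM M θ) ∧
      (∃ C : ℝ, ∀ θ, ∀ M : ℕ, 1 ≤ M → |ℓ θ - ℓM M θ| ≤ C / M) ∧
      (∃ C : ℝ, ∀ θ, ∀ M : ℕ, 1 ≤ M →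
        ℓ θ - ℓM M θ ≤ (ε ^ 8)⁻¹ / (2 * M) + C / (M : ℝ) ^ 2) := by
  have : Nonempty X := by
    by_contra hX
    rw [not_nonempty_iff] at hX
    simp [lintegral_of_isEmpty] at hm₀_one
  have hS : ∀ θ, (S θ).StronglyMixing ε := fun θ =>
    ⟨hε.1, hε.2, fun x x' => (hm θ x x').1, fun x x' => (hm θ x x').2,
      fun x y => (hg θ x y).1, fun x y => (hg θ x y).2⟩
  have hprob := fun θ t y => (hS θ).isProbabilityMeasure_filter hm₀ hm₀_one t y
  choose ℓ hℓ using fun θ => (hS θ).exists_tendsto_logLik hm₀ hm₀_one hD hdata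
  have hex : ∀ (M : ℕ) θ, ∃ l : ℝ, 1 ≤ M → ∀ᵐ ω ∂P, Tendsto (fun T : ℕ => (T : ℝ)⁻¹ *
      ∑ s ∈ Finset.range T, (S θ).iwaeBound (Q θ) M (Ys (s + 1) ω)
        ((S θ).filter m₀ s (fun t => Ys t ω))) atTop (𝓝 l) := by
    intro M θ
    by_cases hM : 1 ≤ M
    · obtain ⟨l, hl⟩ := (hS θ).exists_tendsto_iwaeBound (hr θ) hM hm₀ hm₀_one hD hdata
      exact ⟨l, fun _ => hl⟩
    -- Junk value at `M = 0`, where nothing is claimed.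
    · exact ⟨0, fun h => absurd h hM⟩
  choose ℓM hℓM using hex
  have hle : ∀ θ (M : ℕ), 1 ≤ M → ℓM M θ ≤ ℓ θ := fun θ M hM => by
    obtain ⟨ω, h1, h2⟩ := ((hℓM M θ hM).and (hℓ θ)).exists
    simpa using le_add_of_tendsto_cesaro le_rfl (fun s => by
      simpa using (hS θ).iwaeBound_le_logLik (hr θ) hM _ _) h1 h2
  have hsucc : ∀ θ (M : ℕ), 1 ≤ M → ℓM M θ ≤ ℓM (M + 1) θ := fun θ M hM => by
    obtain ⟨ω, h1, h2⟩ := ((hℓM M θ hM).and (hℓM (M + 1) θ (by omega))).exists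
    simpa using le_add_of_tendsto_cesaro le_rfl (fun s => by
      simpa using (hS θ).iwaeBound_le_succ (hr θ) hM _ _) h1 h2
  have hgap : ∀ θ (M : ℕ), 1 ≤ M → ℓ θ ≤ ℓM M θ + (ε ^ 8)⁻¹ / (2 * M) := fun θ M hM => by
    obtain ⟨ω, h1, h2⟩ := ((hℓ θ).and (hℓM M θ hM)).exists
    have hε0 := hε.1
    exact le_add_of_tendsto_cesaro (by positivity)
      (fun s => (hS θ).logLik_le_iwaeBound_add (hr θ) hM _ _) h1 h2
  refine ⟨ℓ, ℓM, hℓ, fun M hM θ => hℓM M θ hM,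
    fun θ M hM => ⟨hle θ (M + 1) (by omega), hsucc θ M hM⟩,
    -- The first-order bound already holds for every `M`, so the constant of the `1 / M ^ 2` term
    -- can be `0`.
    ⟨(ε ^ 8)⁻¹ / 2, fun θ M hM => ?_⟩, ⟨0, fun θ M hM => ?_⟩⟩
  · rw [abs_of_nonneg (sub_nonneg.2 (hle θ M hM)), div_div]
    linarith [hgap θ M hM]
  · rw [zero_div, add_zero]
    linarith [hgap θ M hM]
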